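/- Let $K\ge 2$ be fixed. Write $\Delta^{K-1}=\{q\in\mathbb R^K: q_i\ge 0,\ \sum_i q_i=1\}$, with relative interior $\mathring\Delta^{K-1}=\{q\in\Delta^{K-1}: q_i>0 \text{ for all } i\}$, and let $\mathcal H=\{v\in\mathbb R^K:\sum_i v_i=0\}$. Let $W\in[0,1]^{K\times K}$ be a symmetric weight matrix such that the graph on $\{1,\dots,K\}$ with an edge between $i\ne j$ whenever $W_{ij}\neq 0$ is connected. Let $L=D-W$ be its Laplacian, where $D$ is diagonal with $D_{ii}=\sum_j W_{ij}$. **Prior.** For fixed $a_q,b_q,a_C,b_C>0$, the prior $\Pi$ on pairs $(q,C)$, with $q\in\Delta^{K-1}$ and $C$ a column-stochastic $K\times K$ matrix, is given by independent $\tau_q\sim\mathrm{Gamma}(a_q,b_q)$ and $\tau_C\sim\mathrm{Gamma}(a_C,b_C)$ (shape, rate) and $$q=\mathrm{softmax}(\theta),\qquad C_{:,i}=\mathrm{softmax}(\phi_i)\quad(i=1,\dots,K).$$ Here, given $(\tau_q,\tau_C)$, the vectors $\theta,\phi_1,\dots,\phi_K\in\mathcal H$ are independent. The vector $\theta$ has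 density proportional to $\exp(-\tfrac{\tau_q}{2}\theta^\top L\theta)$ and each $\phi_i$ has density proportional to $\exp(-\tfrac{\tau_C}{2}\phi_i^\top L\phi_i)$, with respect to Lebesgue measure on $\mathcal H$. **Data.** Let $q_0\in\mathring\Delta^{K-1}$, and let $C_0\in(0,1)^{K\times K}$ satisfy $\sum_j (C_0)_{j,i}=1$ for all $i$ and $\det C_0\ne 0$. For sample sizes $n_1^S,\dots,n_K^S,n'\in\mathbb N$, the data consist of independent count vectors $$N_i^S\sim\mathrm{Multi}(n_i^S,(C_0)_{:,i})\quad(i=1,\dots,K),\qquad \tilde N\sim\mathrm{Multi}(n',C_0q_0).$$ Let $\mathbb P_{(q_0,C_0)}$ denote their joint law. The posterior $\Pi(\cdot\mid\text{data})$ is obtained from $\Pi$ by Bayes' formula with the likelihood $$\Big[\prod_{i=1}^K\mathrm{Multi}(N_i^S;n_i^S,C_{:,i})\Big]\,\mathrm{Multi}(\tilde N;n',Cq).$$ For all sample sizes it is, $\mathbb P_{(q_0,C_0)}$-almost surely, a well-defined probability measure. **Claim.** Consider a sequence of sample sizes all of which diverge: $\min_i n_i^S\to\infty$ and $n'\to\infty$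 (hence also $N:=n'+\sum_i n_i^S\to\infty$). No relation between the rates of divergence is assumed. For $\varepsilon>0$ let $$B_\varepsilon=\{(q,C):\ \|q-q_0\|_2<\varepsilon,\ \|C-C_0\|_F<\varepsilon\}.$$ Then, for every $\varepsilon>0$, $\Pi(B_\varepsilon^c\mid\text{data})\to 0$ in $\mathbb P_{(q_0,C_0)}$-probability, that is, for every $\delta>0$, $$\mathbb P_{(q_0,C_0)}\big(\Pi(B_\varepsilon^c\mid\text{data})>\delta\big)\to 0 .$$ -/

import Mathlib

open MeasureTheory ProbabilityTheory Filter Topology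
open scoped ENNReal Matrix

noncomputable section

namespace LabelShift

variable {K : ℕ}

/-! ### The label graph and its Laplacian -/

/-- The graph on the labels whose edges are the pairs of distinct labels with nonzero weight. -/
def similarityGraph (W : Matrix (Fin K) (Fin K) ℝ) : SimpleGraph (Fin K) :=
  SimpleGraph.fromRel fun i j => W i j ≠ 0

/-- The unnormalised Laplacian `L = D - W`, where `D` is diagonal with `D i i = ∑ j, W i j`. -/
def laplacian (W : Matrix (Fin K) (Fin K) ℝ) : Matrix (Fin K) (Fin K) ℝ :=
  Matrix.diagonal (fun i => ∑ j, W i j) - W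

/-! ### Parameters -/

/-- The (relative) interior of the probability simplex. -/
def openSimplex (K : ℕ) : Set (Fin K → ℝ) :=
  {q | (∀ i, 0 < q i) ∧ ∑ i, q i = 1}

instance instMeasurableSpaceMatrix : MeasurableSpace (Matrix (Fin K) (Fin K) ℝ) :=
  inferInstanceAs (MeasurableSpace (Fin K → Fin K → ℝ))

/-- A parameter `(q, C)`: the target class prior `q` and the confusion matrix `C`, where `C j i`
is the probability of predicting `j` when the true class is `i`. -/
abbrev Param (K : ℕ) : Type := (Fin K → ℝ) × Matrix (Fin K) (Fin K) ℝ

/-- The set of all `(q, C)` with `‖q - q₀‖₂ < ε` (Euclidean norm) and `‖C - C₀‖_F < ε`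
(Frobenius norm). -/
def paramBall (q₀ : Fin K → ℝ) (C₀ : Matrix (Fin K) (Fin K) ℝ) (ε : ℝ) : Set (Param K) :=
  {x | √(∑ i, (x.1 i - q₀ i) ^ 2) < ε ∧ √(∑ j, ∑ i, (x.2 j i - C₀ j i) ^ 2) < ε}

/-! ### Multinomial sampling -/

/-- The multinomial probability mass function with `n` trials and cell probabilities `p`. -/
def multinomialMass (n : ℕ) (p : Fin K → ℝ) (k : Fin K → ℕ) : ℝ :=
  if ∑ j, k j = n then (Nat.multinomial Finset.univ k : ℝ) * ∏ j, p j ^ k j else 0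

/-- The multinomial distribution with `n` trials and cell probabilities `p`. -/
def multinomialLaw (n : ℕ) (p : Fin K → ℝ) : Measure (Fin K → ℕ) :=
  ∑ k ∈ Finset.piAntidiag Finset.univ n,
    ENNReal.ofReal (multinomialMass n p k) • Measure.dirac k

/-- The data: the counts `N i j` of predictions `j` among the source examples with true class `i`,
and the counts of predictions on the unlabelled target examples. -/
abbrev Data (K : ℕ) : Type := (Fin K → Fin K → ℕ) × (Fin K → ℕ)

/-- The law of the data under `(q, C)`: the `K + 1` count vectors are independent, the `i`-th
source vector is multinomial with `nS i` trials and cell probabilities the `i`-th column of `C`,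
and the target vector is multinomial with `nT` trials and cell probabilities `C q`. -/
def dataLaw (nS : Fin K → ℕ) (nT : ℕ) (x : Param K) : Measure (Data K) :=
  (Measure.pi fun i => multinomialLaw (nS i) (fun j => x.2 j i)).prod
    (multinomialLaw nT (x.2 *ᵥ x.1))

/-- The likelihood of the parameter `x` given the data `d`. -/
def likelihood (nS : Fin K → ℕ) (nT : ℕ) (d : Data K) (x : Param K) : ℝ :=
  (∏ i, multinomialMass (nS i) (fun j => x.2 j i) (d.1 i)) * multinomialMass nT (x.2 *ᵥ x.1) d.2

/-! ### The hierarchical Laplacian-Gaussian prior -/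

/-- The hyperplane of vectors with coordinate sum zero. -/
def centered (K : ℕ) : Submodule ℝ (EuclideanSpace ℝ (Fin K)) where
  carrier := {v | ∑ i, v i = 0}
  add_mem' {a b} ha hb := by
    simp only [Set.mem_ofPred_eq, PiLp.add_apply, Finset.sum_add_distrib] at *
    rw [ha, hb, add_zero]
  zero_mem' := by simp
  smul_mem' c a ha := by
    simp only [Set.mem_ofPred_eq, PiLp.smul_apply, smul_eq_mul, ← Finset.mul_sum] at *
    rw [ha, mul_zero]

/-- The unnormalised density `exp (-(τ / 2) vᵀ L v)` on the hyperplane of centered vectors. -/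
def gmrfWeight (L : Matrix (Fin K) (Fin K) ℝ) (τ : ℝ) (v : centered K) : ℝ≥0∞ :=
  ENNReal.ofReal (Real.exp (-(τ / 2) * ((fun i => v.1 i) ⬝ᵥ L *ᵥ fun i => v.1 i)))

/-- The Gaussian Markov random field with precision `τ L`: the probability measure on the
hyperplane of centered vectors whose density with respect to Lebesgue measure on that hyperplane
is proportional to `exp (-(τ / 2) vᵀ L v)`. -/
def gmrf (L : Matrix (Fin K) (Fin K) ℝ) (τ : ℝ) : Measure (centered K) :=
  (∫⁻ v, gmrfWeight L τ v)⁻¹ • volume.withDensity (gmrfWeight L τ)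

/-- The softmax map. -/
def softmax (v : Fin K → ℝ) (j : Fin K) : ℝ := Real.exp (v j) / ∑ l, Real.exp (v l)

/-- The prior of `q`: `τ ∼ Gamma(a, b)` (shape `a`, rate `b`), `θ ∣ τ ∼ gmrf L τ` and
`q = softmax θ`. -/
def priorTarget (L : Matrix (Fin K) (Fin K) ℝ) (a b : ℝ) : Measure (Fin K → ℝ) :=
  ((gammaMeasure a b).bind (gmrf L)).map fun θ => softmax fun i => θ.1 i

/-- The prior of `C`: `τ ∼ Gamma(a, b)` (shape `a`, rate `b`); given `τ`, the vectors `φ i` are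
independent with law `gmrf L τ`; the `i`-th column of `C` is `softmax (φ i)`. -/
def priorConfusion (L : Matrix (Fin K) (Fin K) ℝ) (a b : ℝ) :
    Measure (Matrix (Fin K) (Fin K) ℝ) :=
  ((gammaMeasure a b).bind fun τ => Measure.pi fun _ : Fin K => gmrf L τ).map
    fun φ => Matrix.of fun j i => softmax (fun l => (φ i).1 l) j

/-- The joint prior of `(q, C)`; the two blocks are independent. -/
def jointPrior (L : Matrix (Fin K) (Fin K) ℝ) (aq bq aC bC : ℝ) : Measure (Param K) :=
  (priorTarget L aq bq).prod (priorConfusion L aC bC)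

/-- The posterior of `(q, C)` given the data `d`, by Bayes' formula: the measure whose density
with respect to the prior `ρ` is the likelihood divided by its `ρ`-integral. -/
def posterior (ρ : Measure (Param K)) (nS : Fin K → ℕ) (nT : ℕ) (d : Data K) :
    Measure (Param K) :=
  (∫⁻ x, ENNReal.ofReal (likelihood nS nT d x) ∂ρ)⁻¹ •
    ρ.withDensity fun x => ENNReal.ofReal (likelihood nS nT d x)

/-! ### Well-definedness: the families of measures used above are measurable in `τ`, and the
multinomial distributions are probability measures -/

lemma measurable_gmrfWeight (L : Matrix (Fin K) (Fin K) ℝ) :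
    Measurable (Function.uncurry (gmrfWeight L)) := by
  unfold Function.uncurry gmrfWeight
  refine Continuous.measurable ?_
  refine ENNReal.continuous_ofReal.comp (Real.continuous_exp.comp ?_)
  simp only [dotProduct, Matrix.mulVec]
  fun_prop

instance isFiniteMeasure_gmrf (L : Matrix (Fin K) (Fin K) ℝ) (τ : ℝ) :
    IsFiniteMeasure (gmrf L τ) := by
  refine ⟨?_⟩
  have h : gmrf L τ Set.univ = (∫⁻ v, gmrfWeight L τ v)⁻¹ * ∫⁻ v, gmrfWeight L τ v := by
    simp [gmrf]
  rw [h]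
  exact (ENNReal.inv_mul_le_one _).trans_lt ENNReal.one_lt_top

lemma measurable_gmrf (L : Matrix (Fin K) (Fin K) ℝ) : Measurable (gmrf L) := by
  refine Measure.measurable_of_measurable_coe _ fun s hs => ?_
  have h : ∀ τ, gmrf L τ s =
      (∫⁻ v, gmrfWeight L τ v)⁻¹ * ∫⁻ v in s, gmrfWeight L τ v := by
    intro τ
    simp [gmrf, withDensity_apply _ hs]
  simp only [h]
  exact (Measurable.lintegral_prod_right' (measurable_gmrfWeight L)).inv.mul
    (Measurable.lintegral_prod_right' (measurable_gmrfWeight L))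

lemma measurable_pi_gmrf (L : Matrix (Fin K) (Fin K) ℝ) :
    Measurable fun τ => Measure.pi fun _ : Fin K => gmrf L τ := by
  refine Measurable.measure_of_isPiSystem generateFrom_pi.symm isPiSystem_pi ?_ ?_
  · rintro _ ⟨s, hs, rfl⟩
    simp only [Measure.pi_pi]
    exact Finset.measurable_prod _ fun i _ =>
      (Measure.measurable_coe (show MeasurableSet (s i) by simpa using hs i (Set.mem_univ i))).comp (measurable_gmrf L)
  · simp only [Measure.pi_univ]
    exact Finset.measurable_prod _ fun i _ =>
      (Measure.measurable_coe MeasurableSet.univ).comp (measurable_gmrf L)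

lemma isProbabilityMeasure_multinomialLaw (n : ℕ) {p : Fin K → ℝ} (hp : p ∈ stdSimplex ℝ (Fin K)) :
    IsProbabilityMeasure (multinomialLaw n p) := by
  refine ⟨?_⟩
  have hnn : ∀ k, 0 ≤ multinomialMass n p k := by
    intro k
    unfold multinomialMass
    split_ifs
    · exact mul_nonneg (Nat.cast_nonneg _) (Finset.prod_nonneg fun j _ => pow_nonneg (hp.1 j) _)
    · exact le_rfl
  simp only [multinomialLaw, Measure.coe_finsetSum, Measure.coe_smul, Finset.sum_apply,
    Pi.smul_apply, measure_univ, smul_eq_mul, mul_one]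
  rw [← ENNReal.ofReal_sum_of_nonneg fun k _ => hnn k]
  have h := Finset.sum_pow_eq_sum_piAntidiag Finset.univ p n
  rw [hp.2, one_pow] at h
  rw [← ENNReal.ofReal_one, h]
  congr 1
  refine Finset.sum_congr rfl fun k hk => ?_
  rw [multinomialMass, if_pos (Finset.mem_piAntidiag.1 hk).1]

end LabelShift

end

/-! The posterior mass of the complement is a ratio of two integrals of the likelihood kernel
against the prior. Both are compared with one reference quantity: the product of the `localMass` of
the K + 1 count vectors near the true columns of C₀ and near p₀ = C₀q₀. Once all empirical
frequencies are close to the truth, which by Chernoff bounds happens with probability tending to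
one, the comparison is deterministic (`exists_posterior_compl_le`).

Prior. In the affine chart of the simplex, the law of a softmax-Gaussian vector with precision in
[1, 2] has density bounded below away from the boundary. Its density is bounded above by a negative
power of ∏ c_j, times a factor in the precision that the Gamma law integrates. The singularity at
the boundary is absorbed by a monomial with large exponents (`exists_concentration`).

Denominator (`exists_le_evidence`). For C near C₀ the map q ↦ Cq is an affine isomorphism with
controlled Jacobian, so integrating over q produces the local mass of the target counts; integrating
over the columns then produces theirs.

Numerator. If Cq is near p₀ and every column is either near the truth or has weight q_i < r,
invertibility of C₀ forces q near q₀; then no weight is small and all columns are near the truth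
(`exists_mem_paramBall`). So outside the ball either Cq is far from p₀, or some column i with q_i ≥
r is far from the truth. In the first case the target monomial is uniformly small relative to its
local mass. In the second case the monomial of column i is uniformly small, which leaves column i
free as an integration variable: since q_i ≥ r, the target monomial integrates over it to at most a
constant times its own local mass (`lintegral_mixture_update_le`). Nothing is lost in n', so no
relation between the rates is needed. -/

noncomputable section

namespace LabelShift

variable {K : ℕ}

/-! ### Determinant bounds -/

section Det

variable {E : Type*} [NormedAddCommGroup E] [InnerProductSpace ℝ E] [FiniteDimensional ℝ E]

/-- The unit ball is mapped into the ball of radius R; compare volumes. -/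
lemma abs_det_le_of_norm_le [MeasurableSpace E] [BorelSpace E] (A : E →ₗ[ℝ] E) {R : ℝ} (hR : 0 < R)
    (hA : ∀ x, ‖A x‖ ≤ R * ‖x‖) : |LinearMap.det A| ≤ R ^ Module.finrank ℝ E := by
  have h1 := Measure.addHaar_image_linearMap (volume : Measure E) A (Metric.closedBall 0 1)
  have h2 : A '' Metric.closedBall 0 1 ⊆ Metric.closedBall 0 R := by
    rintro _ ⟨x, hx, rfl⟩
    rw [mem_closedBall_zero_iff] at hx ⊢
    exact (hA x).trans (by nlinarith)
  have h3 := measure_mono (μ := (volume : Measure E)) h2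
  rw [h1, Measure.addHaar_closedBall' (volume : Measure E) 0 hR.le] at h3
  have h4 : volume (Metric.closedBall (0 : E) 1) ≠ 0 :=
    (Metric.measure_closedBall_pos _ _ one_pos).ne'
  have h5 : volume (Metric.closedBall (0 : E) 1) ≠ ⊤ := measure_closedBall_lt_top.ne
  exact (ENNReal.ofReal_le_ofReal_iff (by positivity)).1 ((ENNReal.mul_le_mul_iff_left h4 h5).1 h3)

/-- The preimage of the unit ball lies in the unit ball, and its volume carries the factor 1 / |det
A|. -/
lemma one_le_abs_det_of_norm_ge [MeasurableSpace E] [BorelSpace E] (A : E →ₗ[ℝ] E)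
    (hA : ∀ x, ‖x‖ ≤ ‖A x‖) : 1 ≤ |LinearMap.det A| := by
  have hinj : Function.Injective A := by
    rw [injective_iff_map_eq_zero]
    intro x hx
    have := hA x
    rw [hx, norm_zero] at this
    exact norm_le_zero_iff.1 this
  have hdet : LinearMap.det A ≠ 0 :=
    (LinearMap.isUnit_iff_isUnit_det _ |>.1 ((LinearMap.isUnit_iff_ker_eq_bot _).2
      (LinearMap.ker_eq_bot.2 hinj))).ne_zero
  have h1 := Measure.addHaar_preimage_linearMap (volume : Measure E) hdet (Metric.closedBall 0 1)
  have h2 : A ⁻¹' Metric.closedBall 0 1 ⊆ Metric.closedBall 0 1 := by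
    intro x hx
    rw [Set.mem_preimage, mem_closedBall_zero_iff] at hx
    rw [mem_closedBall_zero_iff]
    exact (hA x).trans hx
  have h3 := measure_mono (μ := (volume : Measure E)) h2
  rw [h1] at h3
  have h4 : volume (Metric.closedBall (0 : E) 1) ≠ 0 :=
    (Metric.measure_closedBall_pos _ _ one_pos).ne'
  have h5 : volume (Metric.closedBall (0 : E) 1) ≠ ⊤ := measure_closedBall_lt_top.ne
  have h6 : ENNReal.ofReal |(LinearMap.det A)⁻¹| ≤ 1 := by
    by_contra! h
    exact absurd h3 (not_le.2 ((ENNReal.mul_lt_mul_iff_left h4 h5).2 h |>.trans_eq' (one_mul _)))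
  rw [ENNReal.ofReal_le_one, abs_inv] at h6
  exact (inv_le_one₀ (abs_pos.2 hdet)).1 h6

end Det

/-! ### The affine chart of the simplex -/

/-- The point of the affine hyperplane `∑ i, c i = 1` with displacement `h` from the barycentre. -/
def simplexPoint (h : centered K) (i : Fin K) : ℝ := (K : ℝ)⁻¹ + h.1 i

/-- The displacements of the points of the open simplex. -/
def simplexChart (K : ℕ) : Set (centered K) := {h | ∀ i, 0 < simplexPoint h i}

lemma mem_centered {v : EuclideanSpace ℝ (Fin K)} : v ∈ centered K ↔ ∑ i, v i = 0 := Iff.rfl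

lemma sum_centered (h : centered K) : ∑ i, h.1 i = 0 := h.2

@[fun_prop]
lemma continuous_simplexPoint : Continuous (simplexPoint (K := K)) := by
  unfold simplexPoint; fun_prop

lemma sum_simplexPoint [NeZero K] (h : centered K) : ∑ i, simplexPoint h i = 1 := by
  have : (K : ℝ) ≠ 0 := by exact_mod_cast NeZero.ne K
  simp [simplexPoint, Finset.sum_add_distrib, sum_centered, this]

lemma simplexPoint_mem [NeZero K] {h : centered K} (hh : h ∈ simplexChart K) :
    simplexPoint h ∈ openSimplex K := ⟨hh, sum_simplexPoint h⟩

lemma isOpen_simplexChart : IsOpen (simplexChart K) := by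
  have : simplexChart K = ⋂ i, {h | 0 < simplexPoint h i} := by ext; simp [simplexChart]
  rw [this]
  exact isOpen_iInter_of_finite fun i => isOpen_lt continuous_const (by unfold simplexPoint; fun_prop)

lemma le_one_of_mem_openSimplex {c : Fin K → ℝ} (hc : c ∈ openSimplex K) (i : Fin K) : c i ≤ 1 := by
  rw [← hc.2]
  exact Finset.single_le_sum (fun j _ => (hc.1 j).le) (Finset.mem_univ i)

/-- The displacement of a point from the barycentre. -/
def displacement [NeZero K] (c : Fin K → ℝ) (hc : ∑ i, c i = 1) : centered K :=
  ⟨WithLp.toLp 2 fun i => c i - (K : ℝ)⁻¹, by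
    have : (K : ℝ) ≠ 0 := by exact_mod_cast NeZero.ne K
    simp [mem_centered, Finset.sum_sub_distrib, hc, this]⟩

@[simp]
lemma simplexPoint_displacement [NeZero K] (c : Fin K → ℝ) (hc : ∑ i, c i = 1) :
    simplexPoint (displacement c hc) = c := by
  ext i; simp [simplexPoint, displacement]

lemma norm_le_of_abs_le (h : centered K) {R : ℝ} (hR : ∀ i, |h.1 i| ≤ R) : ‖h‖ ≤ K * R := by
  rcases Nat.eq_zero_or_pos K with rfl | hK
  · have : h = 0 := by ext i; exact i.elim0
    simp [this]
  · have hR0 : 0 ≤ R := (abs_nonneg _).trans (hR ⟨0, hK⟩)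
    have hK1 : (1 : ℝ) ≤ K := by exact_mod_cast hK
    rw [Submodule.coe_norm, EuclideanSpace.norm_eq]
    refine Real.sqrt_le_iff.2 ⟨by positivity, ?_⟩
    calc ∑ i, ‖h.1 i‖ ^ 2 ≤ ∑ _i : Fin K, R ^ 2 :=
          Finset.sum_le_sum fun i _ => pow_le_pow_left₀ (norm_nonneg _) (hR i) 2
      _ = K * R ^ 2 := by simp
      _ ≤ (K * R) ^ 2 := by nlinarith [sq_nonneg R]

lemma abs_apply_le_norm (h : centered K) (i : Fin K) : |h.1 i| ≤ ‖h‖ := by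
  rw [Submodule.coe_norm, ← Real.norm_eq_abs]
  exact PiLp.norm_apply_le h.1 i

lemma simplexChart_subset_closedBall [NeZero K] :
    simplexChart K ⊆ Metric.closedBall 0 (K : ℝ) := by
  intro h hh
  rw [mem_closedBall_zero_iff]
  refine (norm_le_of_abs_le h (R := 1) fun i => ?_).trans_eq (mul_one _)
  have h1 := hh i
  have h2 := le_one_of_mem_openSimplex (simplexPoint_mem hh) i
  have h3 : (K : ℝ)⁻¹ ≤ 1 := inv_le_one_of_one_le₀ (by exact_mod_cast NeZero.pos K)
  have h4 : (0 : ℝ) ≤ (K : ℝ)⁻¹ := by positivity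
  unfold simplexPoint at h1 h2
  rw [abs_le]; constructor <;> linarith

lemma volume_simplexChart_ne_top [NeZero K] : volume (simplexChart K) ≠ ⊤ :=
  ((measure_mono simplexChart_subset_closedBall).trans_lt measure_closedBall_lt_top).ne

/-! ### Softmax coordinates -/

lemma softmax_pos [NeZero K] (v : Fin K → ℝ) (j : Fin K) : 0 < softmax v j := by
  have : 0 < ∑ l, Real.exp (v l) := Finset.sum_pos (fun l _ => Real.exp_pos _) Finset.univ_nonempty
  unfold softmax; positivity

lemma softmax_mem [NeZero K] (v : Fin K → ℝ) : softmax v ∈ openSimplex K := by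
  refine ⟨softmax_pos v, ?_⟩
  have : 0 < ∑ l, Real.exp (v l) := Finset.sum_pos (fun l _ => Real.exp_pos _) Finset.univ_nonempty
  simp only [softmax, ← Finset.sum_div]
  exact div_self this.ne'

@[fun_prop]
lemma continuous_softmax [NeZero K] : Continuous (softmax (K := K)) := by
  unfold softmax
  refine continuous_pi fun j => Continuous.div (by fun_prop) (by fun_prop) fun v => ?_
  exact (Finset.sum_pos (fun l _ => Real.exp_pos _) Finset.univ_nonempty).ne'

/-- Softmax of a centered vector. -/
def csoftmax (φ : centered K) : Fin K → ℝ := softmax fun i => φ.1 i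

lemma csoftmax_mem [NeZero K] (φ : centered K) : csoftmax φ ∈ openSimplex K := softmax_mem _

@[fun_prop]
lemma continuous_csoftmax [NeZero K] : Continuous (csoftmax (K := K)) :=
  continuous_softmax.comp (by fun_prop)

/-- Subtraction of the mean. -/
def centering (K : ℕ) [NeZero K] : EuclideanSpace ℝ (Fin K) →L[ℝ] centered K :=
  LinearMap.toContinuousLinearMap
    { toFun := fun v => ⟨WithLp.toLp 2 fun i => v i - (K : ℝ)⁻¹ * ∑ j, v j, by
        have : (K : ℝ) ≠ 0 := by exact_mod_cast NeZero.ne K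
        simp [mem_centered, Finset.sum_sub_distrib, this]⟩
      map_add' := fun v w => by
        ext i; simp [Finset.sum_add_distrib]; ring
      map_smul' := fun c v => by
        ext i; simp [← Finset.mul_sum]; ring }

lemma centering_apply [NeZero K] (v : EuclideanSpace ℝ (Fin K)) (i : Fin K) :
    (centering K v).1 i = v i - (K : ℝ)⁻¹ * ∑ j, v j := rfl

/-- The inverse of the softmax map in the affine chart. -/
def logChart [NeZero K] (h : centered K) : centered K :=
  centering K (WithLp.toLp 2 fun i => Real.log (simplexPoint h i))

/-- The derivative of `logChart`. -/
def logChartDeriv [NeZero K] (h : centered K) : centered K →L[ℝ] centered K :=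
  (centering K).comp (LinearMap.toContinuousLinearMap
    { toFun := fun k => WithLp.toLp 2 fun i => (simplexPoint h i)⁻¹ * k.1 i
      map_add' := fun v w => by ext i; simp; ring
      map_smul' := fun c v => by ext i; simp; ring })

lemma logChartDeriv_apply [NeZero K] (h k : centered K) (i : Fin K) :
    (logChartDeriv h k).1 i =
      (simplexPoint h i)⁻¹ * k.1 i - (K : ℝ)⁻¹ * ∑ j, (simplexPoint h j)⁻¹ * k.1 j := rfl

lemma hasFDerivAt_logChart [NeZero K] {h : centered K} (hh : h ∈ simplexChart K) :
    HasFDerivAt logChart (logChartDeriv h) h := by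
  refine (centering K).hasFDerivAt.comp h ?_
  rw [← hasFDerivWithinAt_univ, hasFDerivWithinAt_euclidean]
  intro i
  have h1 : HasFDerivAt (fun k : centered K => simplexPoint k i)
      ((EuclideanSpace.proj i).comp (centered K).subtypeL) h :=
    (((EuclideanSpace.proj (𝕜 := ℝ) i).comp (centered K).subtypeL).hasFDerivAt).const_add _
  exact (h1.log (hh i).ne').hasFDerivWithinAt.congr_fderiv rfl

/-- The logarithm of softmax is φ minus a constant vector, and centering removes the constant. -/
lemma logChart_csoftmax [NeZero K] (φ : centered K) (hs) :
    logChart (displacement (csoftmax φ) hs) = φ := by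
  have hK : (K : ℝ) ≠ 0 := by exact_mod_cast NeZero.ne K
  have h0 : 0 < ∑ l, Real.exp (φ.1 l) :=
    Finset.sum_pos (fun l _ => Real.exp_pos _) Finset.univ_nonempty
  have h1 : ∀ i, Real.log (csoftmax φ i) = φ.1 i - Real.log (∑ l, Real.exp (φ.1 l)) := by
    intro i
    rw [csoftmax, softmax, Real.log_div (Real.exp_pos _).ne' h0.ne', Real.log_exp]
  ext i
  rw [logChart, centering_apply]
  simp [h1, Finset.sum_sub_distrib, sum_centered, hK]

lemma csoftmax_logChart [NeZero K] {h : centered K} (hh : h ∈ simplexChart K) :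
    csoftmax (logChart h) = simplexPoint h := by
  ext i
  have h1 : ∀ j, Real.exp ((logChart h).1 j) =
      simplexPoint h j * Real.exp (-((K : ℝ)⁻¹ * ∑ l, Real.log (simplexPoint h l))) := by
    intro j
    rw [logChart, centering_apply, sub_eq_add_neg, Real.exp_add]
    simp only [Real.exp_log (hh j)]
  simp only [csoftmax, softmax, h1, ← Finset.sum_mul, sum_simplexPoint, one_mul]
  exact mul_div_cancel_right₀ _ (Real.exp_pos _).ne'

lemma injOn_logChart [NeZero K] : Set.InjOn (logChart (K := K)) (simplexChart K) := by
  intro h hh k hk e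
  have := (csoftmax_logChart hh).symm.trans ((congrArg csoftmax e).trans (csoftmax_logChart hk))
  ext i
  have := congrFun this i
  simpa [simplexPoint] using this

lemma image_logChart [NeZero K] : logChart '' simplexChart K = Set.univ := by
  refine Set.eq_univ_of_forall fun φ => ⟨displacement (csoftmax φ) (csoftmax_mem φ).2, ?_,
    logChart_csoftmax φ _⟩
  intro i
  rw [simplexPoint_displacement]
  exact (csoftmax_mem φ).1 i

/-- The dimension of the simplex. -/
abbrev simplexDim (K : ℕ) : ℕ := Module.finrank ℝ (centered K)

/-- A bound, up to a constant, on the Jacobian of the inverse of softmax. -/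
def jacobianBound (c : Fin K → ℝ) : ℝ≥0∞ := ENNReal.ofReal ((∏ j, c j) ^ simplexDim K)⁻¹

/-- All coordinates are at most 1, so each is at least their product and 1 / c_j ≤ 1 / ∏ c. The
bound is crude, but a power of ∏ c merges with a monomial by a shift of exponents. -/
lemma norm_logChartDeriv_le [NeZero K] {h : centered K} (hh : h ∈ simplexChart K) (k : centered K) :
    ‖logChartDeriv h k‖ ≤ (K * 2 * (∏ j, simplexPoint h j)⁻¹) * ‖k‖ := by
  have hK : (0 : ℝ) < K := by exact_mod_cast NeZero.pos K
  set P := ∏ j, simplexPoint h j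
  have hP : 0 < P := Finset.prod_pos fun j _ => hh j
  have hle : ∀ j, P ≤ simplexPoint h j := fun j => by
    have h2 : P = simplexPoint h j * ∏ i ∈ Finset.univ.erase j, simplexPoint h i :=
      (Finset.mul_prod_erase _ _ (Finset.mem_univ j)).symm
    rw [h2]
    refine mul_le_of_le_one_right (hh j).le (Finset.prod_le_one (fun i _ => (hh i).le) fun i _ => ?_)
    exact le_one_of_mem_openSimplex (simplexPoint_mem hh) i
  have hb : ∀ j, |(simplexPoint h j)⁻¹ * k.1 j| ≤ P⁻¹ * ‖k‖ := by
    intro j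
    rw [abs_mul, abs_of_pos (inv_pos.2 (hh j))]
    exact mul_le_mul (inv_anti₀ hP (hle j)) (abs_apply_le_norm k j) (abs_nonneg _) (by positivity)
  have := norm_le_of_abs_le (logChartDeriv h k) (R := 2 * P⁻¹ * ‖k‖) fun i => by
    rw [logChartDeriv_apply]
    have h3 : |(K : ℝ)⁻¹ * ∑ j, (simplexPoint h j)⁻¹ * k.1 j| ≤ P⁻¹ * ‖k‖ := by
      rw [abs_mul, abs_of_pos (inv_pos.2 hK), inv_mul_le_iff₀ hK]
      refine (Finset.abs_sum_le_sum_abs _ _).trans ?_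
      refine (Finset.sum_le_sum fun j _ => hb j).trans_eq ?_
      simp
    refine (abs_sub _ _).trans ?_
    linarith [hb i]
  linarith

/-- Pairing the derivative with k kills the mean term, k being centered, and leaves ∑ k_i² / c_i ≥
‖k‖²; Cauchy–Schwarz concludes. -/
lemma norm_le_norm_logChartDeriv [NeZero K] {h : centered K} (hh : h ∈ simplexChart K)
    (k : centered K) : ‖k‖ ≤ ‖logChartDeriv h k‖ := by
  have h1 : ‖k‖ ^ 2 ≤ inner ℝ (logChartDeriv h k) k := by
    rw [Submodule.coe_inner, Submodule.coe_norm, EuclideanSpace.real_norm_sq_eq, PiLp.inner_apply]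
    simp only [logChartDeriv_apply]
    have : ∀ i, inner ℝ ((simplexPoint h i)⁻¹ * k.1 i -
        (K : ℝ)⁻¹ * ∑ j, (simplexPoint h j)⁻¹ * k.1 j) (k.1 i) =
        (simplexPoint h i)⁻¹ * k.1 i ^ 2 -
          ((K : ℝ)⁻¹ * ∑ j, (simplexPoint h j)⁻¹ * k.1 j) * k.1 i := by
      intro i; simp only [RCLike.inner_apply, conj_trivial]; ring
    simp only [this, Finset.sum_sub_distrib, ← Finset.mul_sum, sum_centered, mul_zero, sub_zero]
    refine Finset.sum_le_sum fun i _ => ?_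
    refine le_mul_of_one_le_left (sq_nonneg _) ?_
    exact (one_le_inv₀ (hh i)).2 (le_one_of_mem_openSimplex (simplexPoint_mem hh) i)
  have h2 := real_inner_le_norm (logChartDeriv h k) k
  by_contra! hlt
  have : 0 < ‖k‖ := (norm_nonneg _).trans_lt hlt
  nlinarith

/-- Change of variables along `logChart`, a bijection from the chart of the open simplex onto the
whole hyperplane. -/
lemma lintegral_csoftmax [NeZero K] (F : (Fin K → ℝ) → ℝ≥0∞) :
    ∫⁻ φ, F (csoftmax φ) = ∫⁻ h in simplexChart K,
      ENNReal.ofReal |(logChartDeriv h).det| * F (simplexPoint h) := by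
  have := lintegral_image_eq_lintegral_abs_det_fderiv_mul (volume : Measure (centered K))
    isOpen_simplexChart.measurableSet
    (fun h hh => (hasFDerivAt_logChart hh).hasFDerivWithinAt) injOn_logChart
    (fun φ => F (csoftmax φ))
  rw [image_logChart, Measure.restrict_univ] at this
  rw [this]
  refine setLIntegral_congr_fun isOpen_simplexChart.measurableSet fun h hh => ?_
  simp only [csoftmax_logChart hh]

lemma lintegral_csoftmax_le [NeZero K] (F : (Fin K → ℝ) → ℝ≥0∞) :
    ∫⁻ φ, F (csoftmax φ) ≤ ENNReal.ofReal ((2 * K) ^ simplexDim K) *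
      ∫⁻ h in simplexChart K, jacobianBound (simplexPoint h) * F (simplexPoint h) := by
  have hK : (0 : ℝ) < K := by exact_mod_cast NeZero.pos K
  rw [lintegral_csoftmax, ← lintegral_const_mul' _ _ ENNReal.ofReal_ne_top]
  refine setLIntegral_mono' isOpen_simplexChart.measurableSet fun h hh => ?_
  rw [← mul_assoc]
  gcongr
  have hP : 0 < ∏ j, simplexPoint h j := Finset.prod_pos fun j _ => hh j
  rw [jacobianBound, ← ENNReal.ofReal_mul (by positivity)]
  refine ENNReal.ofReal_le_ofReal ((abs_det_le_of_norm_le (logChartDeriv h).toLinearMap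
    (by positivity) (norm_logChartDeriv_le hh)).trans_eq ?_)
  rw [← inv_pow, ← mul_pow]
  ring

/-- The Jacobian can be dropped because `logChartDeriv` does not shrink norms. -/
lemma le_lintegral_csoftmax [NeZero K] (F : (Fin K → ℝ) → ℝ≥0∞) :
    ∫⁻ h in simplexChart K, F (simplexPoint h) ≤ ∫⁻ φ, F (csoftmax φ) := by
  rw [lintegral_csoftmax]
  refine setLIntegral_mono' isOpen_simplexChart.measurableSet fun h hh => ?_
  refine le_mul_of_one_le_left' ?_
  rw [ENNReal.one_le_ofReal]
  exact one_le_abs_det_of_norm_ge (logChartDeriv h).toLinearMap (norm_le_norm_logChartDeriv hh)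

/-! ### The Laplacian form -/

/-- The quadratic form of a matrix on centered vectors. -/
def centeredForm (L : Matrix (Fin K) (Fin K) ℝ) (v : centered K) : ℝ :=
  (fun i => v.1 i) ⬝ᵥ L *ᵥ fun i => v.1 i

@[fun_prop]
lemma continuous_centeredForm (L : Matrix (Fin K) (Fin K) ℝ) : Continuous (centeredForm L) := by
  unfold centeredForm
  simp only [dotProduct, Matrix.mulVec]
  fun_prop

lemma centeredForm_smul (L : Matrix (Fin K) (Fin K) ℝ) (t : ℝ) (v : centered K) :
    centeredForm L (t • v) = t ^ 2 * centeredForm L v := by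
  have : (fun i => (t • v).1 i) = t • fun i => v.1 i := by ext i; simp
  rw [centeredForm, this, Matrix.mulVec_smul, smul_dotProduct, dotProduct_smul, centeredForm]
  simp only [smul_eq_mul]; ring

/-- The Dirichlet form of the graph. The factor 2 appears because the double sum meets each edge
twice; diagonal weights cancel. -/
lemma two_mul_centeredForm_laplacian {W : Matrix (Fin K) (Fin K) ℝ} (hW : W.IsSymm)
    (v : centered K) :
    2 * centeredForm (laplacian W) v = ∑ i, ∑ j, W i j * (v.1 i - v.1 j) ^ 2 := by
  have h1 : centeredForm (laplacian W) v =
      ∑ i, ∑ j, W i j * v.1 i ^ 2 - ∑ i, ∑ j, W i j * (v.1 i * v.1 j) := by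
    simp only [centeredForm, laplacian, Matrix.sub_mulVec, dotProduct_sub]
    congr 1
    · simp only [dotProduct, Matrix.mulVec_diagonal]
      refine Finset.sum_congr rfl fun i _ => ?_
      rw [Finset.sum_mul, Finset.mul_sum]
      exact Finset.sum_congr rfl fun j _ => by ring
    · simp only [dotProduct, Matrix.mulVec]
      refine Finset.sum_congr rfl fun i _ => ?_
      rw [Finset.mul_sum]
      exact Finset.sum_congr rfl fun j _ => by ring
  have h2 : ∑ i, ∑ j, W i j * v.1 j ^ 2 = ∑ i, ∑ j, W i j * v.1 i ^ 2 := by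
    rw [Finset.sum_comm]
    exact Finset.sum_congr rfl fun i _ => Finset.sum_congr rfl fun j _ => by rw [hW.apply]
  have h3 : ∑ i, ∑ j, W i j * (v.1 i - v.1 j) ^ 2 =
      ∑ i, ∑ j, W i j * v.1 i ^ 2 + ∑ i, ∑ j, W i j * v.1 j ^ 2
        - 2 * ∑ i, ∑ j, W i j * (v.1 i * v.1 j) := by
    simp only [Finset.mul_sum, ← Finset.sum_add_distrib, ← Finset.sum_sub_distrib]
    exact Finset.sum_congr rfl fun i _ => Finset.sum_congr rfl fun j _ => by ring
  rw [h3, h2, h1]; ring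

/-- If the form vanishes, v is constant along edges, hence constant by connectedness, hence zero
because it is centered. -/
lemma centeredForm_laplacian_pos {W : Matrix (Fin K) (Fin K) ℝ} (hW : W.IsSymm)
    (hW0 : ∀ i j, 0 ≤ W i j) (hconn : (similarityGraph W).Connected) {v : centered K}
    (hv : v ≠ 0) : 0 < centeredForm (laplacian W) v := by
  have hterm : ∀ i j, 0 ≤ W i j * (v.1 i - v.1 j) ^ 2 := fun i j =>
    mul_nonneg (hW0 i j) (sq_nonneg _)
  have h2 := two_mul_centeredForm_laplacian hW v
  by_contra! hle
  have h0 : ∑ i, ∑ j, W i j * (v.1 i - v.1 j) ^ 2 = 0 :=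
    le_antisymm (by linarith) (Finset.sum_nonneg fun i _ => Finset.sum_nonneg fun j _ => hterm i j)
  have hz : ∀ i j, W i j * (v.1 i - v.1 j) ^ 2 = 0 := by
    intro i j
    have h4 := (Finset.sum_eq_zero_iff_of_nonneg
      (fun i _ => Finset.sum_nonneg fun j _ => hterm i j)).1 h0 i (Finset.mem_univ i)
    exact (Finset.sum_eq_zero_iff_of_nonneg (fun j _ => hterm i j)).1 h4 j (Finset.mem_univ j)
  have hWeq : ∀ i j, W i j ≠ 0 → v.1 i = v.1 j := fun i j hij => by
    have := (mul_eq_zero.1 (hz i j)).resolve_left hij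
    exact sub_eq_zero.1 (pow_eq_zero_iff two_ne_zero |>.1 this)
  have hadj : ∀ i j, (similarityGraph W).Adj i j → v.1 i = v.1 j := by
    intro i j hij
    rw [similarityGraph, SimpleGraph.fromRel_adj] at hij
    rcases hij.2 with h | h
    · exact hWeq i j h
    · exact (hWeq j i h).symm
  have hall : ∀ i j, v.1 i = v.1 j := by
    intro i j
    obtain ⟨p⟩ := hconn.preconnected i j
    induction p with
    | nil => rfl
    | cons h _ ih => exact (hadj _ _ h).trans ih
  apply hv
  ext i
  have hs := sum_centered v
  have : (K : ℝ) ≠ 0 := by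
    have : 0 < K := i.pos
    positivity
  simp only [hall _ i, Finset.sum_const, Finset.card_univ, Fintype.card_fin, nsmul_eq_mul] at hs
  simpa [this] using hs

/-- Minimum over the compact unit sphere, extended by homogeneity. -/
lemma exists_coercive {L : Matrix (Fin K) (Fin K) ℝ} (hL : ∀ v : centered K, v ≠ 0 → 0 < centeredForm L v) :
    ∃ c > 0, ∀ v : centered K, c * ‖v‖ ^ 2 ≤ centeredForm L v := by
  -- The sphere is empty exactly when the hyperplane is trivial.
  rcases (Metric.sphere (0 : centered K) 1).eq_empty_or_nonempty with he | hne
  · refine ⟨1, one_pos, fun v => ?_⟩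
    by_cases hv : v = 0
    · subst hv
      have := centeredForm_smul L 0 0
      simp at this; simp [this]
    · have : (‖v‖⁻¹ • v) ∈ Metric.sphere (0 : centered K) 1 := by
        simp [norm_smul, hv]
      rw [he] at this; exact this.elim
  · obtain ⟨w, hw, hmin⟩ := (isCompact_sphere (0 : centered K) 1).exists_isMinOn hne
      (continuous_centeredForm L).continuousOn
    have hw0 : w ≠ 0 := by
      rintro rfl; simp at hw
    refine ⟨centeredForm L w, hL w hw0, fun v => ?_⟩
    by_cases hv : v = 0
    · subst hv
      have := centeredForm_smul L 0 0
      simp at this; simp [this]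
    · have h1 : (‖v‖⁻¹ • v) ∈ Metric.sphere (0 : centered K) 1 := by
        simp [norm_smul, hv]
      have h2 : centeredForm L w ≤ centeredForm L (‖v‖⁻¹ • v) := hmin h1
      rw [centeredForm_smul, inv_pow, inv_mul_eq_div, le_div_iff₀ (by positivity)] at h2
      exact h2

/-! ### Bounds for the Gaussian Markov random field -/

lemma gmrfWeight_eq (L : Matrix (Fin K) (Fin K) ℝ) (τ : ℝ) (v : centered K) :
    gmrfWeight L τ v = ENNReal.ofReal (Real.exp (-(τ / 2) * centeredForm L v)) := rfl

@[fun_prop]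
lemma measurable_gmrfWeight' (L : Matrix (Fin K) (Fin K) ℝ) (τ : ℝ) :
    Measurable (gmrfWeight L τ) := (measurable_gmrfWeight L).of_uncurry_left

lemma lintegral_gmrf (L : Matrix (Fin K) (Fin K) ℝ) (τ : ℝ) {F : centered K → ℝ≥0∞}
    (hF : Measurable F) :
    ∫⁻ v, F v ∂gmrf L τ = (∫⁻ v, gmrfWeight L τ v)⁻¹ * ∫⁻ v, gmrfWeight L τ v * F v := by
  rw [gmrf, lintegral_smul_measure, lintegral_withDensity_eq_lintegral_mul _ (by fun_prop) hF]
  rfl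

lemma gmrf_univ_le_one (L : Matrix (Fin K) (Fin K) ℝ) (τ : ℝ) : gmrf L τ Set.univ ≤ 1 := by
  have h : gmrf L τ Set.univ = (∫⁻ v, gmrfWeight L τ v)⁻¹ * ∫⁻ v, gmrfWeight L τ v := by
    simp [gmrf]
  rw [h]
  exact ENNReal.inv_mul_le_one _

/-- The weight is at most 1, and it is at least exp(-sτ) on the neighbourhood of 0 where the form is
below 2s, which bounds the normalising constant from below. The exponential growth in τ is wasteful,
but s is arbitrary and can be fitted to the Gamma tail. -/
lemma exists_lintegral_gmrf_le {L : Matrix (Fin K) (Fin K) ℝ} (hL : ∀ v, 0 ≤ centeredForm L v)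
    {s : ℝ} (hs : 0 < s) :
    ∃ M : ℝ≥0∞, M ≠ ⊤ ∧ ∀ τ : ℝ, 0 ≤ τ → ∀ F : centered K → ℝ≥0∞, Measurable F →
      ∫⁻ v, F v ∂gmrf L τ ≤ M * ENNReal.ofReal (Real.exp (s * τ)) * ∫⁻ v, F v := by
  have h0 : centeredForm L 0 = 0 := by simpa using centeredForm_smul L 0 0
  set U := {v : centered K | centeredForm L v < 2 * s}
  have hU : IsOpen U := isOpen_lt (by fun_prop) continuous_const
  have hU0 : volume U ≠ 0 := (hU.measure_pos _ ⟨0, by simp [U, h0, hs]⟩).ne'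
  refine ⟨(volume U)⁻¹, ENNReal.inv_ne_top.2 hU0, fun τ hτ F hF => ?_⟩
  rw [lintegral_gmrf L τ hF]
  gcongr
  · have h1 : ENNReal.ofReal (Real.exp (-(s * τ))) * volume U ≤ ∫⁻ v, gmrfWeight L τ v := by
      rw [← setLIntegral_const]
      refine (setLIntegral_mono' hU.measurableSet fun v hv => ?_).trans (setLIntegral_le_lintegral U _)
      rw [gmrfWeight_eq]
      refine ENNReal.ofReal_le_ofReal (Real.exp_le_exp.2 ?_)
      have : centeredForm L v < 2 * s := hv
      nlinarith
    refine (ENNReal.inv_le_inv.2 h1).trans_eq ?_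
    rw [ENNReal.mul_inv (Or.inl (by simp [Real.exp_pos])) (Or.inl ENNReal.ofReal_ne_top), mul_comm,
      ← ENNReal.ofReal_inv_of_pos (Real.exp_pos _), Real.exp_neg, inv_inv]
  · refine mul_le_of_le_one_left' ?_
    rw [gmrfWeight_eq, ENNReal.ofReal_le_one, Real.exp_le_one_iff]
    have := hL ‹_›
    nlinarith

lemma lintegral_gmrfWeight_one_ne_top {L : Matrix (Fin K) (Fin K) ℝ}
    (hL : ∀ v : centered K, v ≠ 0 → 0 < centeredForm L v) : ∫⁻ v, gmrfWeight L 1 v ≠ ⊤ := by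
  obtain ⟨c, hc, hcL⟩ := exists_coercive hL
  have h1 := (GaussianFourier.integrable_cexp_neg_mul_sq_norm_add (V := centered K)
    (b := ((c / 2 : ℝ) : ℂ)) (by simpa using hc) 0 0).norm
  refine ne_top_of_le_ne_top h1.lintegral_lt_top.ne (lintegral_mono fun v => ?_)
  rw [gmrfWeight_eq]
  refine ENNReal.ofReal_le_ofReal ?_
  rw [Complex.norm_exp, Real.exp_le_exp]
  have h2 : (-((c / 2 : ℝ) : ℂ) * (‖v‖ : ℂ) ^ 2 + 0 * ((inner ℝ 0 v : ℝ) : ℂ)).re = -(c / 2) * ‖v‖ ^ 2 := by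
    norm_cast; simp
  rw [h2]
  nlinarith [hcL v]

/-- For τ in [1, 2] the normalising constant is at most its value at τ = 1, and on the ball the
weight is at least exp(-R), with R the maximum of the form there. -/
lemma exists_le_lintegral_gmrf {L : Matrix (Fin K) (Fin K) ℝ}
    (hL : ∀ v : centered K, v ≠ 0 → 0 < centeredForm L v) (B : ℝ) :
    ∃ κ : ℝ≥0∞, κ ≠ 0 ∧ ∀ τ ∈ Set.Icc (1 : ℝ) 2, ∀ F : centered K → ℝ≥0∞, Measurable F →
      κ * ∫⁻ v in Metric.closedBall 0 B, F v ≤ ∫⁻ v, F v ∂gmrf L τ := by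
  have hL0 : ∀ v : centered K, 0 ≤ centeredForm L v := by
    intro v
    by_cases hv : v = 0
    · have := centeredForm_smul L 0 v
      rw [hv]; simp at this; simp [this]
    · exact (hL v hv).le
  obtain ⟨R, hR⟩ := (isCompact_closedBall (0 : centered K) B).bddAbove_image
    (continuous_centeredForm L).continuousOn
  refine ⟨(∫⁻ v, gmrfWeight L 1 v)⁻¹ * ENNReal.ofReal (Real.exp (-R)), ?_, fun τ hτ F hF => ?_⟩
  · refine mul_ne_zero (ENNReal.inv_ne_zero.2 (lintegral_gmrfWeight_one_ne_top hL)) ?_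
    simp [Real.exp_pos]
  · rw [lintegral_gmrf L τ hF, mul_assoc]
    gcongr with v
    · rw [gmrfWeight_eq, gmrfWeight_eq]
      refine ENNReal.ofReal_le_ofReal (Real.exp_le_exp.2 ?_)
      nlinarith [hL0 v, hτ.1]
    · rw [← lintegral_const_mul _ hF]
      refine (setLIntegral_mono' measurableSet_closedBall fun v hv => ?_).trans
        (setLIntegral_le_lintegral _ _)
      gcongr
      rw [gmrfWeight_eq]
      refine ENNReal.ofReal_le_ofReal (Real.exp_le_exp.2 ?_)
      have : centeredForm L v ≤ R := hR ⟨v, hv, rfl⟩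
      nlinarith [hL0 v, hτ.2]

/-! ### Gamma hyperpriors -/

lemma ae_nonneg_gammaMeasure (a b : ℝ) : ∀ᵐ τ ∂gammaMeasure a b, 0 ≤ τ := by
  have : {τ : ℝ | ¬ 0 ≤ τ} = Set.Iio 0 := by ext; simp
  rw [ae_iff, this, gammaMeasure, withDensity_apply _ measurableSet_Iio,
    lintegral_gammaPDF_of_nonpos le_rfl]

/-- Tilting the Gamma(a, b) density by exp(bτ/2) gives 2^a times the Gamma(a, b/2) density. -/
lemma lintegral_exp_gammaMeasure_ne_top {a b : ℝ} (ha : 0 < a) (hb : 0 < b) :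
    ∫⁻ τ, ENNReal.ofReal (Real.exp (b / 2 * τ)) ∂gammaMeasure a b ≠ ⊤ := by
  have h1 : ∀ τ, (gammaPDF a b * fun τ => ENNReal.ofReal (Real.exp (b / 2 * τ))) τ ≤
      ENNReal.ofReal (2 ^ a) * gammaPDF a (b / 2) τ := by
    intro τ
    rw [Pi.mul_apply]
    rcases lt_or_ge τ 0 with h | h
    · simp [gammaPDF_of_neg h]
    · rw [gammaPDF_of_nonneg h, gammaPDF_of_nonneg h, ← ENNReal.ofReal_mul (by positivity),
        ← ENNReal.ofReal_mul (by positivity)]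
      refine ENNReal.ofReal_le_ofReal (le_of_eq ?_)
      have h2 : Real.exp (-(b * τ)) * Real.exp (b / 2 * τ) = Real.exp (-(b / 2 * τ)) := by
        rw [← Real.exp_add]; ring_nf
      have h3 : (2 : ℝ) ^ a * (b / 2) ^ a = b ^ a := by
        rw [← Real.mul_rpow (by norm_num) (by positivity)]; ring_nf
      rw [mul_assoc, h2, ← h3]; ring
  have h0 : Measurable (gammaPDF a b) := (measurable_gammaPDFReal a b).ennreal_ofReal
  rw [gammaMeasure, lintegral_withDensity_eq_lintegral_mul _ h0 (by fun_prop)]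
  refine ne_top_of_le_ne_top ?_ (lintegral_mono h1)
  rw [lintegral_const_mul' _ _ ENNReal.ofReal_ne_top, lintegral_gammaPDF_eq_one ha (by positivity)]
  simp

lemma gammaMeasure_Icc_ne_zero {a b : ℝ} (ha : 0 < a) (hb : 0 < b) :
    gammaMeasure a b (Set.Icc 1 2) ≠ 0 := by
  rw [gammaMeasure, withDensity_apply _ measurableSet_Icc]
  refine ((setLIntegral_pos_iff (measurable_gammaPDFReal a b).ennreal_ofReal).2 ?_).ne'
  refine lt_of_lt_of_le ?_ (measure_mono (s := Set.Icc (1 : ℝ) 2) fun τ hτ => ⟨?_, hτ⟩)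
  · simp
  · rw [Function.mem_support]
    have := gammaPDFReal_pos ha hb (lt_of_lt_of_le one_pos hτ.1)
    simpa using this

/-! ### Products of measures -/

/-- Tonelli with coordinate i innermost: the factor g, which couples all coordinates, is disposed of
there by a bound uniform in the others. What remains is a pure product. -/
lemma lintegral_pi_prod_mul_le {X : Type*} [MeasurableSpace X] (μ : Measure X) [SigmaFinite μ]
    {f : Fin K → X → ℝ≥0∞} (hf : ∀ i, Measurable (f i)) {g : (Fin K → X) → ℝ≥0∞} (hg : Measurable g)
    (i : Fin K) {γ : ℝ≥0∞} {B : Fin K → ℝ≥0∞} (hB : ∀ j ≠ i, ∫⁻ x, f j x ∂μ ≤ B j)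
    (hi : ∀ y : Fin K → X, ∫⁻ x, f i x * g (Function.update y i x) ∂μ ≤ γ * B i) :
    ∫⁻ y, (∏ j, f j (y j)) * g y ∂Measure.pi (fun _ => μ) ≤ γ * ∏ j, B j := by
  classical
  -- Integrating out, one at a time, coordinates other than i.
  have key : ∀ s : Finset (Fin K), i ∉ s → ∀ x,
      (∫⋯∫⁻_s, (fun y => ∏ j ∈ s, f j (y j)) ∂fun _ => μ) x ≤ ∏ j ∈ s, B j := by
    intro s
    induction s using Finset.induction_on with
    | empty => intro _ x; simp
    | insert k s hk ih =>
      intro his x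
      rw [lmarginal_insert' _ (by fun_prop) hk]
      have hki : k ≠ i := fun h => his (by simp [h])
      have h1 : ∀ y : Fin K → X, ∫⁻ z, ∏ j ∈ insert k s, f j (Function.update y k z j) ∂μ =
          (∫⁻ z, f k z ∂μ) * ∏ j ∈ s, f j (y j) := by
        intro y
        rw [← lintegral_mul_const _ (hf k)]
        refine lintegral_congr fun z => ?_
        rw [Finset.prod_insert hk, Function.update_self]
        congr 1
        refine Finset.prod_congr rfl fun j hj => ?_
        rw [Function.update_of_ne (by rintro rfl; exact hk hj)]
      simp only [h1]
      rw [Finset.prod_insert hk, lmarginal, lintegral_const_mul _ (by fun_prop)]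
      exact mul_le_mul' (hB k hki) (ih (fun h => his (Finset.mem_insert_of_mem h)) x)
  have hmeas : Measurable fun y : Fin K → X => (∏ j, f j (y j)) * g y := by fun_prop
  rcases isEmpty_or_nonempty (Fin K → X) with he | ⟨⟨x₀⟩⟩
  · simp
  rw [lintegral_eq_lmarginal_univ x₀, lmarginal_erase' _ hmeas (Finset.mem_univ i)]
  have h2 : ∀ y : Fin K → X, ∫⁻ z, (∏ j, f j (Function.update y i z j)) *
      g (Function.update y i z) ∂μ ≤ γ * B i * ∏ j ∈ Finset.univ.erase i, f j (y j) := by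
    intro y
    refine le_trans (le_of_eq ?_) (mul_le_mul_left (hi y) _)
    rw [← lintegral_mul_const _ (by fun_prop)]
    refine lintegral_congr fun z => ?_
    rw [← Finset.mul_prod_erase _ _ (Finset.mem_univ i), Function.update_self]
    have : ∏ j ∈ Finset.univ.erase i, f j (Function.update y i z j) =
        ∏ j ∈ Finset.univ.erase i, f j (y j) :=
      Finset.prod_congr rfl fun j hj => by rw [Function.update_of_ne (Finset.ne_of_mem_erase hj)]
    rw [this]; ring
  refine (lmarginal_mono h2 x₀).trans ?_
  rw [lmarginal, lintegral_const_mul _ (by fun_prop), ← Finset.mul_prod_erase _ _ (Finset.mem_univ i),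
    ← mul_assoc]
  gcongr
  exact key _ (by simp) x₀

lemma lintegral_pi_prod {X : Type*} [MeasurableSpace X] (μ : Measure X) [SigmaFinite μ] {n : ℕ}
    {f : Fin n → X → ℝ≥0∞} (hf : ∀ i, Measurable (f i)) :
    ∫⁻ y, ∏ j, f j (y j) ∂Measure.pi (fun _ => μ) = ∏ j, ∫⁻ x, f j x ∂μ := by
  induction n with
  | zero => simp
  | succ n ih =>
    have h := (measurePreserving_piFinSuccAbove (fun _ : Fin (n + 1) => μ) 0).symm
    rw [← h.lintegral_comp (by fun_prop), Fin.prod_univ_succ, ← ih fun i => hf i.succ,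
      ← lintegral_prod_mul (hf 0).aemeasurable
        (Finset.measurable_prod _ fun j _ => (hf j.succ).comp (measurable_pi_apply j)).aemeasurable]
    refine lintegral_congr fun z => ?_
    rw [Fin.prod_univ_succ]
    rfl

/-! ### Bounds for the priors -/

/-- The displacements of the points of the simplex with all coordinates at least `β`. -/
def chartGe (K : ℕ) (β : ℝ) : Set (centered K) := {h | ∀ i, β ≤ simplexPoint h i}

lemma measurableSet_chartGe (β : ℝ) : MeasurableSet (chartGe K β) := by
  have : chartGe K β = ⋂ i, {h | β ≤ simplexPoint h i} := by ext; simp [chartGe]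
  rw [this]
  exact MeasurableSet.iInter fun i => measurableSet_le measurable_const
    (Continuous.measurable (by unfold simplexPoint; fun_prop))

lemma chartGe_subset {β : ℝ} (hβ : 0 < β) : chartGe K β ⊆ simplexChart K :=
  fun _ hh i => hβ.trans_le (hh i)

/-- φ is log c minus its mean, and every log c_j lies in [log β, 0]. So points away from the
boundary come from a fixed ball, on which the Gaussian density is bounded below. -/
lemma norm_le_of_le_csoftmax [NeZero K] {φ : centered K} {β : ℝ} (hβ : 0 < β)
    (h : ∀ j, β ≤ csoftmax φ j) : ‖φ‖ ≤ K * (-Real.log β) := by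
  have hK : (0 : ℝ) < K := by exact_mod_cast NeZero.pos K
  refine norm_le_of_abs_le φ fun i => ?_
  have h0 : φ.1 i = Real.log (csoftmax φ i) - (K : ℝ)⁻¹ * ∑ j, Real.log (csoftmax φ j) := by
    conv_lhs => rw [← logChart_csoftmax φ (csoftmax_mem φ).2, logChart, centering_apply]
    simp
  have h1 : ∀ j, Real.log β ≤ Real.log (csoftmax φ j) := fun j => Real.log_le_log hβ (h j)
  have h2 : ∀ j, Real.log (csoftmax φ j) ≤ 0 := fun j =>
    Real.log_nonpos ((csoftmax_mem φ).1 j).le (le_one_of_mem_openSimplex (csoftmax_mem φ) j)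
  have h3 : Real.log β ≤ (K : ℝ)⁻¹ * ∑ j, Real.log (csoftmax φ j) := by
    rw [le_inv_mul_iff₀ hK]
    have := Finset.sum_le_sum fun j (_ : j ∈ Finset.univ) => h1 j
    simpa using this
  have h4 : (K : ℝ)⁻¹ * ∑ j, Real.log (csoftmax φ j) ≤ 0 :=
    mul_nonpos_of_nonneg_of_nonpos (by positivity) (Finset.sum_nonpos fun j _ => h2 j)
  rw [h0, abs_le]
  constructor <;> linarith [h1 i, h2 i]

/-- Away from the boundary the prior dominates a multiple of Lebesgue measure in the chart,
uniformly over precisions in [1, 2]. -/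
lemma exists_le_lintegral_csoftmax_gmrf [NeZero K] {L : Matrix (Fin K) (Fin K) ℝ}
    (hL : ∀ v : centered K, v ≠ 0 → 0 < centeredForm L v) {β : ℝ} (hβ : 0 < β) :
    ∃ κ : ℝ≥0∞, κ ≠ 0 ∧ ∀ τ ∈ Set.Icc (1 : ℝ) 2, ∀ F : (Fin K → ℝ) → ℝ≥0∞, Measurable F →
      κ * ∫⁻ h in chartGe K β, F (simplexPoint h) ≤ ∫⁻ φ, F (csoftmax φ) ∂gmrf L τ := by
  obtain ⟨κ, hκ, hle⟩ := exists_le_lintegral_gmrf hL (K * (-Real.log β))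
  refine ⟨κ, hκ, fun τ hτ F hF => le_trans ?_ (hle τ hτ (fun φ => F (csoftmax φ)) (by fun_prop))⟩
  refine mul_le_mul_right ?_ _
  set A : Set (Fin K → ℝ) := {c | ∀ i, β ≤ c i}
  have h1 := le_lintegral_csoftmax (A.indicator F)
  calc ∫⁻ h in chartGe K β, F (simplexPoint h)
      = ∫⁻ h in chartGe K β, A.indicator F (simplexPoint h) := by
        refine setLIntegral_congr_fun (measurableSet_chartGe β) fun h hh => ?_
        simp only [Set.indicator_of_mem (show simplexPoint h ∈ A from hh)]
    _ ≤ ∫⁻ h in simplexChart K, A.indicator F (simplexPoint h) :=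
        lintegral_mono_set (chartGe_subset hβ)
    _ ≤ ∫⁻ φ, A.indicator F (csoftmax φ) := h1
    _ ≤ ∫⁻ φ in Metric.closedBall 0 (K * (-Real.log β)), F (csoftmax φ) := by
        rw [← lintegral_indicator measurableSet_closedBall]
        refine lintegral_mono fun φ => ?_
        by_cases hφ : csoftmax φ ∈ A
        · have : φ ∈ Metric.closedBall (0 : centered K) (K * (-Real.log β)) :=
            mem_closedBall_zero_iff.2 (norm_le_of_le_csoftmax hβ hφ)
          rw [Set.indicator_of_mem hφ, Set.indicator_of_mem this]
        · rw [Set.indicator_of_notMem hφ]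
          exact zero_le

lemma lintegral_priorTarget [NeZero K] (L : Matrix (Fin K) (Fin K) ℝ) (a b : ℝ)
    {F : (Fin K → ℝ) → ℝ≥0∞} (hF : Measurable F) :
    ∫⁻ q, F q ∂priorTarget L a b = ∫⁻ τ, ∫⁻ θ, F (csoftmax θ) ∂gmrf L τ ∂gammaMeasure a b := by
  have h : Measurable fun θ : centered K => softmax fun i => θ.1 i :=
    continuous_csoftmax.measurable
  rw [priorTarget, lintegral_map hF h]
  exact Measure.lintegral_bind (measurable_gmrf L).aemeasurable (hF.comp h).aemeasurable

lemma measurable_matrix {X : Type*} [MeasurableSpace X] {f : X → Matrix (Fin K) (Fin K) ℝ}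
    (hf : ∀ j i, Measurable fun x => f x j i) : Measurable f :=
  measurable_pi_iff.2 fun j => measurable_pi_iff.2 fun i => hf j i

lemma measurable_matrix_apply (j i : Fin K) :
    Measurable fun C : Matrix (Fin K) (Fin K) ℝ => C j i :=
  (measurable_pi_apply i).comp (measurable_pi_apply (X := fun _ : Fin K => Fin K → ℝ) j)

/-- The columns of a matrix. -/
def columns (C : Matrix (Fin K) (Fin K) ℝ) (i j : Fin K) : ℝ := C j i

@[fun_prop]
lemma measurable_columns : Measurable (columns (K := K)) :=
  measurable_pi_iff.2 fun i => measurable_pi_iff.2 fun j => measurable_matrix_apply j i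

lemma measurable_ofColumns [NeZero K] : Measurable fun φ : Fin K → centered K =>
    Matrix.of fun j i => softmax (fun l => (φ i).1 l) j :=
  measurable_matrix fun j i => ((continuous_apply j).comp
    (continuous_csoftmax.comp (continuous_apply i))).measurable

lemma lintegral_priorConfusion [NeZero K] (L : Matrix (Fin K) (Fin K) ℝ) (a b : ℝ)
    {F : (Fin K → Fin K → ℝ) → ℝ≥0∞} (hF : Measurable F) :
    ∫⁻ C, F (columns C) ∂priorConfusion L a b =
      ∫⁻ τ, ∫⁻ φ, F (fun i => csoftmax (φ i)) ∂Measure.pi (fun _ : Fin K => gmrf L τ)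
        ∂gammaMeasure a b := by
  rw [priorConfusion, lintegral_map (by fun_prop) measurable_ofColumns]
  exact Measure.lintegral_bind (measurable_pi_gmrf L).aemeasurable
    ((hF.comp measurable_columns).comp measurable_ofColumns).aemeasurable

/-- In the upper bounds the prior of q enters only through having mass at most 1; bounds uniform in
q suffice. -/
lemma lintegral_priorTarget_le [NeZero K] (L : Matrix (Fin K) (Fin K) ℝ) {a b : ℝ} (ha : 0 < a)
    (hb : 0 < b) {F : (Fin K → ℝ) → ℝ≥0∞} (hF : Measurable F) {D : ℝ≥0∞}
    (hD : ∀ q ∈ openSimplex K, F q ≤ D) : ∫⁻ q, F q ∂priorTarget L a b ≤ D := by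
  have := isProbabilityMeasure_gammaMeasure ha hb
  rw [lintegral_priorTarget L a b hF]
  calc ∫⁻ τ, ∫⁻ θ, F (csoftmax θ) ∂gmrf L τ ∂gammaMeasure a b
      ≤ ∫⁻ τ, D ∂gammaMeasure a b := by
        refine lintegral_mono fun τ => (lintegral_mono fun θ => hD _ (csoftmax_mem θ)).trans ?_
        rw [lintegral_const]
        exact mul_le_of_le_one_right' (gmrf_univ_le_one L τ)
    _ = D := by simp

lemma lintegral_priorConfusion_le [NeZero K] (L : Matrix (Fin K) (Fin K) ℝ) {a b : ℝ} (ha : 0 < a)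
    (hb : 0 < b) {F : (Fin K → Fin K → ℝ) → ℝ≥0∞} (hF : Measurable F) {D : ℝ≥0∞}
    (hD : ∀ c, (∀ i, c i ∈ openSimplex K) → F c ≤ D) :
    ∫⁻ C, F (columns C) ∂priorConfusion L a b ≤ D := by
  have := isProbabilityMeasure_gammaMeasure ha hb
  rw [lintegral_priorConfusion L a b hF]
  calc ∫⁻ τ, ∫⁻ φ, F (fun i => csoftmax (φ i)) ∂Measure.pi (fun _ : Fin K => gmrf L τ)
        ∂gammaMeasure a b
      ≤ ∫⁻ τ, D ∂gammaMeasure a b := by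
        refine lintegral_mono fun τ =>
          (lintegral_mono fun φ => hD _ fun i => csoftmax_mem _).trans ?_
        rw [lintegral_const, Measure.pi_univ]
        exact mul_le_of_le_one_right'
          (Finset.prod_le_one (fun _ _ => zero_le) fun _ _ => gmrf_univ_le_one L τ)
    _ = D := by simp

lemma isFiniteMeasure_priorTarget [NeZero K] (L : Matrix (Fin K) (Fin K) ℝ) {a b : ℝ} (ha : 0 < a)
    (hb : 0 < b) : IsFiniteMeasure (priorTarget L a b) := by
  have := lintegral_priorTarget_le L ha hb (F := fun _ => 1) measurable_const (D := 1) (by simp)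
  rw [lintegral_one] at this
  exact ⟨this.trans_lt ENNReal.one_lt_top⟩

lemma isFiniteMeasure_priorConfusion [NeZero K] (L : Matrix (Fin K) (Fin K) ℝ) {a b : ℝ}
    (ha : 0 < a) (hb : 0 < b) : IsFiniteMeasure (priorConfusion L a b) := by
  have := lintegral_priorConfusion_le L ha hb (F := fun _ => 1) measurable_const (D := 1) (by simp)
  rw [lintegral_one] at this
  exact ⟨this.trans_lt ENNReal.one_lt_top⟩

lemma exists_le_lintegral_priorTarget [NeZero K] {L : Matrix (Fin K) (Fin K) ℝ}
    (hL : ∀ v : centered K, v ≠ 0 → 0 < centeredForm L v) {a b : ℝ} (ha : 0 < a) (hb : 0 < b)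
    {β : ℝ} (hβ : 0 < β) :
    ∃ κ : ℝ≥0∞, κ ≠ 0 ∧ ∀ F : (Fin K → ℝ) → ℝ≥0∞, Measurable F →
      κ * ∫⁻ h in chartGe K β, F (simplexPoint h) ≤ ∫⁻ q, F q ∂priorTarget L a b := by
  obtain ⟨κ, hκ, hle⟩ := exists_le_lintegral_csoftmax_gmrf hL hβ
  refine ⟨gammaMeasure a b (Set.Icc 1 2) * κ, mul_ne_zero (gammaMeasure_Icc_ne_zero ha hb) hκ,
    fun F hF => ?_⟩
  rw [lintegral_priorTarget L a b hF, mul_assoc, mul_comm, ← setLIntegral_const]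
  exact (setLIntegral_mono' measurableSet_Icc fun τ hτ => hle τ hτ F hF).trans
    (setLIntegral_le_lintegral _ _)

lemma exists_le_lintegral_priorConfusion [NeZero K] {L : Matrix (Fin K) (Fin K) ℝ}
    (hL : ∀ v : centered K, v ≠ 0 → 0 < centeredForm L v) {a b : ℝ} (ha : 0 < a) (hb : 0 < b)
    {β : ℝ} (hβ : 0 < β) :
    ∃ κ : ℝ≥0∞, κ ≠ 0 ∧ ∀ f : Fin K → (Fin K → ℝ) → ℝ≥0∞, (∀ i, Measurable (f i)) →
      κ * ∏ i, ∫⁻ h in chartGe K β, f i (simplexPoint h) ≤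
        ∫⁻ C, ∏ i, f i (columns C i) ∂priorConfusion L a b := by
  obtain ⟨κ, hκ, hle⟩ := exists_le_lintegral_csoftmax_gmrf hL hβ
  refine ⟨gammaMeasure a b (Set.Icc 1 2) * κ ^ K,
    mul_ne_zero (gammaMeasure_Icc_ne_zero ha hb) (pow_ne_zero _ hκ), fun f hf => ?_⟩
  have hm : Measurable fun c : Fin K → Fin K → ℝ => ∏ i, f i (c i) := by fun_prop
  rw [lintegral_priorConfusion L a b hm, mul_assoc, mul_comm, ← setLIntegral_const]
  refine (setLIntegral_mono' measurableSet_Icc fun τ hτ => ?_).trans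
    (setLIntegral_le_lintegral _ _)
  rw [lintegral_pi_prod (gmrf L τ) (f := fun i φ => f i (csoftmax φ)) fun i => by fun_prop]
  calc κ ^ K * ∏ i, ∫⁻ h in chartGe K β, f i (simplexPoint h)
      = ∏ i, κ * ∫⁻ h in chartGe K β, f i (simplexPoint h) := by
        rw [Finset.prod_mul_distrib]; simp
    _ ≤ _ := Finset.prod_le_prod' fun i _ => hle τ hτ (f i) (hf i)

/-- The columns are independent only given the precision. Conditionally, `lintegral_pi_prod_mul_le`
applies with column i as the coupled one, and the resulting dependence on the precision is
integrated at the end. -/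
lemma exists_lintegral_priorConfusion_le [NeZero K] {L : Matrix (Fin K) (Fin K) ℝ}
    (hL : ∀ v : centered K, 0 ≤ centeredForm L v) {a b : ℝ} (ha : 0 < a) (hb : 0 < b) :
    ∃ M : ℝ≥0∞, M ≠ ⊤ ∧ ∀ (f : Fin K → (Fin K → ℝ) → ℝ≥0∞) (g : (Fin K → Fin K → ℝ) → ℝ≥0∞),
      (∀ i, Measurable (f i)) → Measurable g → ∀ (i : Fin K) (γ : ℝ≥0∞) (B : Fin K → ℝ≥0∞),
      (∀ j ≠ i, ∫⁻ h in simplexChart K,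
        jacobianBound (simplexPoint h) * f j (simplexPoint h) ≤ B j) →
      (∀ c : Fin K → Fin K → ℝ, (∀ j, c j ∈ openSimplex K) → ∫⁻ h in simplexChart K,
        jacobianBound (simplexPoint h) * (f i (simplexPoint h) *
          g (Function.update c i (simplexPoint h))) ≤ γ * B i) →
      ∫⁻ C, (∏ j, f j (columns C j)) * g (columns C) ∂priorConfusion L a b ≤ M * (γ * ∏ j, B j) := by
  have hK : (0 : ℝ) < K := by exact_mod_cast NeZero.pos K
  -- With s = b / (2K) the K columns together cost exp(bτ/2), which the Gamma(a, b) law integrates.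
  obtain ⟨M, hM, hle⟩ := exists_lintegral_gmrf_le hL (s := b / 2 / K) (by positivity)
  set M' := M * ENNReal.ofReal ((2 * K) ^ simplexDim K)
  have hM' : M' ≠ ⊤ := ENNReal.mul_ne_top hM ENNReal.ofReal_ne_top
  refine ⟨M' ^ K * ∫⁻ τ, ENNReal.ofReal (Real.exp (b / 2 * τ)) ∂gammaMeasure a b,
    ENNReal.mul_ne_top (ENNReal.pow_ne_top hM') (lintegral_exp_gammaMeasure_ne_top ha hb),
    fun f g hf hg i γ B hB hi => ?_⟩
  have hone : ∀ τ : ℝ, 0 ≤ τ → ∀ F : (Fin K → ℝ) → ℝ≥0∞, Measurable F →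
      ∀ D, ∫⁻ h in simplexChart K, jacobianBound (simplexPoint h) * F (simplexPoint h) ≤ D →
      ∫⁻ φ, F (csoftmax φ) ∂gmrf L τ ≤ M' * ENNReal.ofReal (Real.exp (b / 2 / K * τ)) * D := by
    intro τ hτ F hF D hD
    refine (hle τ hτ _ (by fun_prop)).trans ?_
    refine (mul_le_mul_right ((lintegral_csoftmax_le F).trans (mul_le_mul_right hD _)) _).trans_eq ?_
    simp only [M']; ring
  have hm : Measurable fun c : Fin K → Fin K → ℝ => (∏ j, f j (c j)) * g c := by fun_prop
  rw [lintegral_priorConfusion L a b hm]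
  have hτ : ∀ᵐ τ ∂gammaMeasure a b, ∫⁻ φ, (∏ j, f j (csoftmax (φ j))) *
      g (fun i => csoftmax (φ i)) ∂Measure.pi (fun _ : Fin K => gmrf L τ) ≤
      ENNReal.ofReal (Real.exp (b / 2 * τ)) * (M' ^ K * (γ * ∏ j, B j)) := by
    filter_upwards [ae_nonneg_gammaMeasure a b] with τ hτ
    refine (lintegral_pi_prod_mul_le (gmrf L τ) (f := fun j φ => f j (csoftmax φ))
      (g := fun φ => g fun i => csoftmax (φ i)) (fun j => by fun_prop) (by fun_prop) i (γ := γ)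
      (B := fun j => M' * ENNReal.ofReal (Real.exp (b / 2 / K * τ)) * B j)
      (fun j hj => hone τ hτ _ (hf j) _ (hB j hj)) fun y => ?_).trans_eq ?_
    · have h1 : ∀ x, (fun j => csoftmax (Function.update y i x j)) =
          Function.update (fun j => csoftmax (y j)) i (csoftmax x) := by
        intro x; ext j l
        by_cases hj : j = i
        · subst hj; simp
        · simp [hj]
      simp only [h1]
      refine (hone τ hτ (fun c => f i c * g (Function.update (fun j => csoftmax (y j)) i c))
        ?_ _ (hi _ fun j => csoftmax_mem (y j))).trans_eq ?_
      · exact (hf i).mul (hg.comp (measurable_update _))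
      · ring
    · rw [Finset.prod_mul_distrib, Finset.prod_const, Finset.card_univ, Fintype.card_fin, mul_pow,
        ← ENNReal.ofReal_pow (Real.exp_pos _).le, ← Real.exp_nat_mul]
      have : (K : ℝ) * (b / 2 / K * τ) = b / 2 * τ := by field_simp
      rw [this]; ring
  refine (lintegral_mono_ae hτ).trans_eq ?_
  rw [lintegral_mul_const _ (by fun_prop)]
  ring

/-! ### Concentration of the multinomial likelihood -/

/-- The monomial `∏ j, c j ^ k j`. -/
def monomialWeight (k : Fin K → ℕ) (c : Fin K → ℝ) : ℝ≥0∞ := ENNReal.ofReal (∏ j, c j ^ k j)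

@[fun_prop]
lemma measurable_monomialWeight (k : Fin K → ℕ) : Measurable (monomialWeight k) := by
  unfold monomialWeight; fun_prop

lemma monomialWeight_le_one (k : Fin K → ℕ) {c : Fin K → ℝ} (hc : c ∈ openSimplex K) :
    monomialWeight k c ≤ 1 := by
  rw [monomialWeight, ENNReal.ofReal_le_one]
  exact Finset.prod_le_one (fun j _ => pow_nonneg (hc.1 j).le _) fun j _ =>
    pow_le_one₀ (hc.1 j).le (le_one_of_mem_openSimplex hc j)

lemma monomialWeight_ne_zero (k : Fin K → ℕ) {c : Fin K → ℝ} (hc : c ∈ openSimplex K) :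
    monomialWeight k c ≠ 0 := by
  rw [monomialWeight, Ne, ENNReal.ofReal_eq_zero, not_le]
  exact Finset.prod_pos fun j _ => pow_pos (hc.1 j) _

lemma monomialWeight_eq_exp (k : Fin K → ℕ) {c : Fin K → ℝ} (hc : c ∈ openSimplex K) :
    monomialWeight k c = ENNReal.ofReal (Real.exp (∑ j, (k j : ℝ) * Real.log (c j))) := by
  rw [monomialWeight, Real.exp_sum]
  congr 1
  refine Finset.prod_congr rfl fun j _ => ?_
  rw [Real.exp_nat_mul, Real.exp_log (hc.1 j)]

lemma one_le_jacobianBound {c : Fin K → ℝ} (hc : c ∈ openSimplex K) : 1 ≤ jacobianBound c := by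
  rw [jacobianBound, ENNReal.one_le_ofReal]
  have h0 : 0 < ∏ j, c j := Finset.prod_pos fun j _ => hc.1 j
  refine (one_le_inv₀ (by positivity)).2 (pow_le_one₀ h0.le ?_)
  exact Finset.prod_le_one (fun j _ => (hc.1 j).le) fun j _ => le_one_of_mem_openSimplex hc j

/-- The Jacobian bound lowers every exponent by the dimension of the simplex. -/
lemma jacobianBound_mul_monomialWeight (k : Fin K → ℕ) {c : Fin K → ℝ} (hc : c ∈ openSimplex K) :
    jacobianBound c * monomialWeight k c =
      ENNReal.ofReal (Real.exp (∑ j, ((k j : ℝ) - simplexDim K) * Real.log (c j))) := by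
  rw [monomialWeight_eq_exp k hc, jacobianBound, ← ENNReal.ofReal_mul
    (inv_nonneg.2 (pow_nonneg (Finset.prod_nonneg fun j _ => (hc.1 j).le) _))]
  congr 1
  simp only [sub_mul, Finset.sum_sub_distrib, Real.exp_sub]
  rw [← Finset.mul_sum, Real.exp_nat_mul, ← Real.log_prod fun j _ => (hc.1 j).ne',
    Real.exp_log (Finset.prod_pos fun j _ => hc.1 j)]
  rw [inv_mul_eq_div]

/-- A quadratic lower bound on the Kullback–Leibler divergence through the Hellinger distance: log x
≤ x - 1 at x = √(c/p) gives p log(c/p) ≤ (c - p) - (√c - √p)², and (c - p)² ≤ 4(√c - √p)² on [0, 1].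
The terms c - p sum to zero. -/
lemma sum_mul_log_le {p c : Fin K → ℝ} (hp : p ∈ openSimplex K) (hc : c ∈ openSimplex K) :
    ∑ j, p j * Real.log (c j) ≤ ∑ j, p j * Real.log (p j) - ∑ j, (c j - p j) ^ 2 / 4 := by
  have h : ∀ j, p j * Real.log (c j) ≤
      p j * Real.log (p j) + (c j - p j) - (c j - p j) ^ 2 / 4 := by
    intro j
    have hpj := hp.1 j
    have hcj := hc.1 j
    have hs : 0 < √(c j / p j) := Real.sqrt_pos.2 (by positivity)
    have h1 : Real.log (c j) = Real.log (p j) + 2 * Real.log (√(c j / p j)) := by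
      rw [Real.log_sqrt (by positivity), Real.log_div hcj.ne' hpj.ne']; ring
    have h2 := Real.log_le_sub_one_of_pos hs
    rw [Real.sqrt_div hcj.le] at h1 h2
    set x := √(c j)
    set y := √(p j)
    have hx : x ^ 2 = c j := Real.sq_sqrt hcj.le
    have hy : y ^ 2 = p j := Real.sq_sqrt hpj.le
    have hx0 : 0 < x := Real.sqrt_pos.2 hcj
    have hy0 : 0 < y := Real.sqrt_pos.2 hpj
    have hx1 : x ≤ 1 := Real.sqrt_le_one.2 (le_one_of_mem_openSimplex hc j)
    have hy1 : y ≤ 1 := Real.sqrt_le_one.2 (le_one_of_mem_openSimplex hp j)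
    rw [h1, ← hx, ← hy]
    have h3 : y ^ 2 * Real.log (x / y) ≤ y * x - y ^ 2 := by
      have := mul_le_mul_of_nonneg_left h2 (sq_nonneg y)
      have h4 : y ^ 2 * (x / y - 1) = y * x - y ^ 2 := by field_simp
      linarith
    have h5 : (x ^ 2 - y ^ 2) ^ 2 ≤ 4 * (x - y) ^ 2 := by
      have : (x ^ 2 - y ^ 2) ^ 2 = (x + y) ^ 2 * (x - y) ^ 2 := by ring
      rw [this]
      exact mul_le_mul_of_nonneg_right (by nlinarith) (sq_nonneg _)
    nlinarith
  have hs := Finset.sum_le_sum fun j (_ : j ∈ Finset.univ) => h j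
  rw [Finset.sum_sub_distrib, Finset.sum_add_distrib, Finset.sum_sub_distrib, hp.2, hc.2] at hs
  linarith

/-- Two exponent vectors are needed because the Jacobian lowers the exponents at the far point c and
not at the near point b. All logarithms are nonpositive, so one-sided bounds on the exponents
suffice. -/
lemma exists_sum_log_gap {p : Fin K → ℝ} (hp : p ∈ openSimplex K) {r : ℝ} (hr : 0 < r) :
    ∃ η > 0, ∃ s > 0, ∃ ρ > 0, ∀ t : ℝ, 0 ≤ t → ∀ c ∈ openSimplex K, c ∉ Metric.ball p r →
      ∀ b ∈ openSimplex K, b ∈ Metric.ball p ρ → ∀ k k' : Fin K → ℝ,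
      (∀ j, (1 - s) * (t * p j) ≤ k j) → (∀ j, k' j ≤ (1 + s) * (t * p j)) →
      ∑ j, k j * Real.log (c j) + t * η ≤ ∑ j, k' j * Real.log (b j) := by
  set H := ∑ j, p j * Real.log (p j)
  have hcont : ContinuousAt (fun b : Fin K → ℝ => ∑ j, p j * Real.log (b j)) p := by
    refine tendsto_finsetSum _ fun j _ => ?_
    exact ((continuousAt_apply j p).log (hp.1 j).ne').const_mul _
  have hev := hcont.eventually_mem (lt_mem_nhds (show H - r ^ 2 / 32 < H by linarith [sq_pos_of_pos hr]))
  obtain ⟨ρ, hρ, hball⟩ := Metric.eventually_nhds_iff_ball.1 hev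
  -- The divergence gains r² / 4 and continuity at p loses r² / 32. Rescaling the exponents by 1 ± s
  -- must not use up the rest: s|H| ≤ r² / 64, and s ≤ 1/2 retains half of the gain.
  set s := min (1 / 2) (r ^ 2 / 64 / (|H| + 1))
  have hs : 0 < s := by positivity
  have hs1 : s ≤ 1 / 2 := min_le_left _ _
  have hs2 : s * (|H| + 1) ≤ r ^ 2 / 64 := by
    rw [← le_div_iff₀ (by positivity)]; exact min_le_right _ _
  refine ⟨r ^ 2 / 32, by positivity, s, hs, ρ, hρ, fun t ht c hc hcr b hb hbρ k k' hk hk' => ?_⟩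
  have hlog : ∀ {x : Fin K → ℝ}, x ∈ openSimplex K → ∀ j, Real.log (x j) ≤ 0 := fun hx j =>
    Real.log_nonpos (hx.1 j).le (le_one_of_mem_openSimplex hx j)
  have h1 : ∑ j, k j * Real.log (c j) ≤ (1 - s) * t * ∑ j, p j * Real.log (c j) := by
    rw [Finset.mul_sum]
    refine Finset.sum_le_sum fun j _ => ?_
    have := mul_le_mul_of_nonpos_right (hk j) (hlog hc j)
    linarith
  have h2 : (1 + s) * t * ∑ j, p j * Real.log (b j) ≤ ∑ j, k' j * Real.log (b j) := by
    rw [Finset.mul_sum]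
    refine Finset.sum_le_sum fun j _ => ?_
    have := mul_le_mul_of_nonpos_right (hk' j) (hlog hb j)
    linarith
  have h3 : ∑ j, p j * Real.log (c j) ≤ H - r ^ 2 / 4 := by
    refine (sum_mul_log_le hp hc).trans ?_
    have : r ^ 2 / 4 ≤ ∑ j, (c j - p j) ^ 2 / 4 := by
      rw [Metric.mem_ball, dist_pi_lt_iff hr] at hcr
      push Not at hcr
      obtain ⟨i, hi⟩ := hcr
      refine le_trans ?_ (Finset.single_le_sum (f := fun j => (c j - p j) ^ 2 / 4)
        (fun j _ => by positivity) (Finset.mem_univ i))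
      rw [Real.dist_eq] at hi
      have := pow_le_pow_left₀ hr.le hi 2
      rw [sq_abs] at this
      linarith
    linarith
  have h4 : H - r ^ 2 / 32 ≤ ∑ j, p j * Real.log (b j) := (hball b hbρ).le
  have h5 : -|H| ≤ H := neg_abs_le H
  have h6 : (1 - s) * t * ∑ j, p j * Real.log (c j) ≤ (1 - s) * t * (H - r ^ 2 / 4) :=
    mul_le_mul_of_nonneg_left h3 (mul_nonneg (by linarith) ht)
  have h7 : (1 + s) * t * (H - r ^ 2 / 32) ≤ (1 + s) * t * ∑ j, p j * Real.log (b j) :=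
    mul_le_mul_of_nonneg_left h4 (mul_nonneg (by linarith) ht)
  have h8 : (1 - s) * (H - r ^ 2 / 4) + r ^ 2 / 32 ≤ (1 + s) * (H - r ^ 2 / 32) := by
    have : s * (-H) ≤ r ^ 2 / 64 := (mul_le_mul_of_nonneg_left (by linarith) hs.le).trans hs2
    nlinarith [sq_nonneg r]
  have h9 := mul_le_mul_of_nonneg_left h8 ht
  linarith

/-- The displacements of the points in a ball (for the supremum norm). -/
def chartBall (p : Fin K → ℝ) (r : ℝ) : Set (centered K) := simplexPoint ⁻¹' Metric.ball p r

lemma isOpen_chartBall (p : Fin K → ℝ) (r : ℝ) : IsOpen (chartBall p r) :=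
  Metric.isOpen_ball.preimage continuous_simplexPoint

lemma volume_chartBall_ne_zero [NeZero K] {p : Fin K → ℝ} (hp : p ∈ openSimplex K) {r : ℝ}
    (hr : 0 < r) : volume (chartBall p r) ≠ 0 :=
  ((isOpen_chartBall p r).measure_pos _
    ⟨displacement p hp.2, by simp [chartBall, hr]⟩).ne'

lemma half_le_of_mem_ball {p c : Fin K → ℝ} {r : ℝ} (hrp : ∀ j, r ≤ p j / 2)
    (hc : c ∈ Metric.ball p r) (j : Fin K) : p j / 2 ≤ c j := by
  have h1 := (dist_le_pi_dist c p j).trans_lt hc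
  rw [Real.dist_eq, abs_lt] at h1
  linarith [hrp j]

lemma chartBall_subset {p : Fin K → ℝ} (hp : p ∈ openSimplex K) {r : ℝ} (hrp : ∀ j, r ≤ p j / 2) :
    chartBall p r ⊆ simplexChart K := fun h hh j =>
  lt_of_lt_of_le (by have := hp.1 j; linarith) (half_le_of_mem_ball hrp hh j)

/-- The mass of a monomial near a point of the simplex. -/
def localMass (p : Fin K → ℝ) (r : ℝ) (k : Fin K → ℕ) : ℝ≥0∞ :=
  ∫⁻ h in chartBall p r, monomialWeight k (simplexPoint h)

lemma localMass_ne_zero [NeZero K] {p : Fin K → ℝ} (hp : p ∈ openSimplex K) {r : ℝ} (hr : 0 < r)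
    (hrp : ∀ j, r ≤ p j / 2) (k : Fin K → ℕ) : localMass p r k ≠ 0 := by
  rw [localMass]
  refine ((setLIntegral_pos_iff (by fun_prop)).2 ?_).ne'
  refine (pos_iff_ne_zero.2 (volume_chartBall_ne_zero hp hr)).trans_le (measure_mono fun h hh => ?_)
  exact ⟨monomialWeight_ne_zero k (simplexPoint_mem (chartBall_subset hp hrp hh)), hh⟩

lemma localMass_ne_top [NeZero K] {p : Fin K → ℝ} (hp : p ∈ openSimplex K) {r : ℝ}
    (hrp : ∀ j, r ≤ p j / 2) (k : Fin K → ℕ) : localMass p r k ≠ ⊤ := by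
  refine ne_top_of_le_ne_top (volume_simplexChart_ne_top (K := K)) ?_
  calc localMass p r k ≤ ∫⁻ h in chartBall p r, 1 :=
        setLIntegral_mono' (isOpen_chartBall p r).measurableSet fun h hh =>
          monomialWeight_le_one k (simplexPoint_mem (chartBall_subset hp hrp hh))
    _ = volume (chartBall p r) := by simp
    _ ≤ _ := measure_mono (chartBall_subset hp hrp)

/-- On a small ball V around p the monomial exceeds its Jacobian-weighted value at any far point by
exp(nη). Averaging over V makes far values at most exp(-nη) / vol V times the local mass. For the
total, the Jacobian is bounded near p, and the far part has finite volume. -/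
lemma exists_concentration [NeZero K] {p : Fin K → ℝ} (hp : p ∈ openSimplex K) {r : ℝ} (hr : 0 < r)
    (hrp : ∀ j, r ≤ p j / 2) :
    ∃ M : ℝ≥0∞, M ≠ ⊤ ∧ ∃ γ : ℕ → ℝ≥0∞, Tendsto γ atTop (𝓝 0) ∧ ∃ s > 0, ∃ n₀ : ℕ,
      ∀ n ≥ n₀, ∀ k : Fin K → ℕ, (∀ j, |(k j : ℝ) - n * p j| ≤ s * n) →
      (∀ c ∈ openSimplex K, c ∉ Metric.ball p r →
        jacobianBound c * monomialWeight k c ≤ γ n * localMass p r k) ∧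
      ∫⁻ h in simplexChart K, jacobianBound (simplexPoint h) * monomialWeight k (simplexPoint h) ≤
        M * localMass p r k := by
  obtain ⟨η, hη, s, hs, ρ, hρ, hgap⟩ := exists_sum_log_gap hp hr
  obtain ⟨i₀, hi₀⟩ := Finite.exists_min p
  set m := p i₀
  have hm : 0 < m := hp.1 i₀
  set V := chartBall p (min ρ r)
  have hV0 : volume V ≠ 0 := volume_chartBall_ne_zero hp (lt_min hρ hr)
  have hVS : V ⊆ chartBall p r := Set.preimage_mono (Metric.ball_subset_ball (min_le_right _ _))
  have hVtop : volume V ≠ ⊤ := ne_top_of_le_ne_top volume_simplexChart_ne_top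
    (measure_mono (hVS.trans (chartBall_subset hp hrp)))
  set γ : ℕ → ℝ≥0∞ := fun n => (volume V * ENNReal.ofReal (Real.exp (n * η)))⁻¹
  have hγ : Tendsto γ atTop (𝓝 0) := by
    rw [← ENNReal.inv_top]
    refine Tendsto.inv ?_
    have h1 : Tendsto (fun n : ℕ => ENNReal.ofReal (Real.exp (n * η))) atTop (𝓝 ⊤) :=
      ENNReal.tendsto_ofReal_nhds_top.2 (Real.tendsto_exp_atTop.comp
        (tendsto_natCast_atTop_atTop.atTop_mul_const hη))
    have h2 := ENNReal.Tendsto.const_mul (a := volume V) h1 (Or.inl ENNReal.top_ne_zero)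
    rwa [ENNReal.mul_top hV0] at h2
  have hγ1 : ∀ n, γ n ≤ (volume V)⁻¹ := fun n => by
    refine ENNReal.inv_le_inv.2 (le_mul_of_one_le_right' ?_)
    rw [ENNReal.one_le_ofReal, Real.one_le_exp_iff]
    positivity
  set w : ℝ≥0∞ := ENNReal.ofReal ((∏ j, p j / 2) ^ simplexDim K)⁻¹
  -- Half of the slack s·m·n goes to the deviation of the counts and half to the exponents removed
  -- by the Jacobian, which forces the choice of n₀.
  refine ⟨w + volume (simplexChart K) * (volume V)⁻¹, ?_, γ, hγ, s * m / 2, by positivity,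
    ⌈2 * simplexDim K / (s * m)⌉₊, fun n hn k hk => ?_⟩
  · exact ENNReal.add_ne_top.2 ⟨ENNReal.ofReal_ne_top,
      ENNReal.mul_ne_top volume_simplexChart_ne_top (ENNReal.inv_ne_top.2 hV0)⟩
  have hn' : (simplexDim K : ℝ) ≤ s * m / 2 * n := by
    have h1 : 2 * simplexDim K / (s * m) ≤ (n : ℝ) := (Nat.le_ceil _).trans (by exact_mod_cast hn)
    rw [div_le_iff₀ (by positivity)] at h1
    linarith
  have hn0 : (0 : ℝ) ≤ n := Nat.cast_nonneg n
  have hmp : ∀ j, s * m * n ≤ s * (n * p j) := fun j => by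
    have := mul_le_mul_of_nonneg_left (hi₀ j) (mul_nonneg hs.le hn0)
    linarith
  have hfar : ∀ c ∈ openSimplex K, c ∉ Metric.ball p r →
      jacobianBound c * monomialWeight k c ≤ γ n * localMass p r k := by
    intro c hc hcr
    have h1 : ∀ h ∈ V, jacobianBound c * monomialWeight k c * ENNReal.ofReal (Real.exp (n * η)) ≤
        monomialWeight k (simplexPoint h) := by
      intro h hh
      have hS := simplexPoint_mem (chartBall_subset hp hrp (hVS hh))
      rw [jacobianBound_mul_monomialWeight k hc, monomialWeight_eq_exp k hS,
        ← ENNReal.ofReal_mul (Real.exp_pos _).le, ← Real.exp_add]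
      refine ENNReal.ofReal_le_ofReal (Real.exp_le_exp.2 ?_)
      refine hgap n hn0 c hc hcr _ hS (Metric.ball_subset_ball (min_le_left _ _) hh) _ _
        (fun j => ?_) fun j => ?_
      · have := (abs_le.1 (hk j)).1
        linarith [hmp j]
      · have := (abs_le.1 (hk j)).2
        have h3 : 0 ≤ s * m * n := by positivity
        linarith [hmp j]
    have h2 : jacobianBound c * monomialWeight k c * ENNReal.ofReal (Real.exp (n * η)) * volume V ≤
        localMass p r k := by
      rw [← setLIntegral_const]
      exact (setLIntegral_mono' (isOpen_chartBall _ _).measurableSet h1).trans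
        (lintegral_mono_set hVS)
    have h3 : volume V * ENNReal.ofReal (Real.exp (n * η)) ≠ 0 :=
      mul_ne_zero hV0 (by simp [Real.exp_pos])
    have h4 : volume V * ENNReal.ofReal (Real.exp (n * η)) ≠ ⊤ :=
      ENNReal.mul_ne_top hVtop ENNReal.ofReal_ne_top
    simp only [γ]
    rw [mul_comm _ (localMass p r k), ← div_eq_mul_inv, ENNReal.le_div_iff_mul_le (Or.inl h3) (Or.inl h4)]
    refine le_trans (le_of_eq ?_) h2
    ring
  refine ⟨hfar, ?_⟩
  have hsub := chartBall_subset hp hrp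
  refine (lintegral_mono_set (Set.inter_union_sdiff (simplexChart K) (chartBall p r)).ge).trans ?_
  refine (lintegral_union_le _ _ _).trans ?_
  rw [add_mul]
  refine add_le_add ?_ ?_
  · rw [Set.inter_eq_self_of_subset_right hsub, localMass,
      ← lintegral_const_mul' _ _ ENNReal.ofReal_ne_top]
    refine setLIntegral_mono' (isOpen_chartBall p r).measurableSet fun h hh => ?_
    gcongr
    refine ENNReal.ofReal_le_ofReal (inv_anti₀ ?_ ?_)
    · exact pow_pos (Finset.prod_pos fun j _ => half_pos (hp.1 j)) _
    · refine pow_le_pow_left₀ (Finset.prod_nonneg fun j _ => (half_pos (hp.1 j)).le) ?_ _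
      exact Finset.prod_le_prod (fun j _ => (half_pos (hp.1 j)).le) fun j _ =>
        half_le_of_mem_ball hrp hh j
  · calc ∫⁻ h in simplexChart K \ chartBall p r,
          jacobianBound (simplexPoint h) * monomialWeight k (simplexPoint h)
        ≤ ∫⁻ h in simplexChart K \ chartBall p r, (volume V)⁻¹ * localMass p r k :=
          setLIntegral_mono' (isOpen_simplexChart.measurableSet.diff
            (isOpen_chartBall p r).measurableSet) fun h hh =>
            (hfar _ (simplexPoint_mem hh.1) hh.2).trans (mul_le_mul_left (hγ1 n) _)
      _ = volume (simplexChart K \ chartBall p r) * ((volume V)⁻¹ * localMass p r k) := by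
          rw [setLIntegral_const, mul_comm]
      _ ≤ volume (simplexChart K) * ((volume V)⁻¹ * localMass p r k) := by
          gcongr; exact Set.sdiff_subset
      _ = _ := by ring

/-! ### Mixtures of columns -/

/-- The mixture with weights `q` of the columns `c`. -/
def mixture (q : Fin K → ℝ) (c : Fin K → Fin K → ℝ) (l : Fin K) : ℝ := ∑ i, c i l * q i

lemma mulVec_eq_mixture (C : Matrix (Fin K) (Fin K) ℝ) (q : Fin K → ℝ) :
    C *ᵥ q = mixture q (columns C) := rfl

@[fun_prop]
lemma continuous_mixture :
    Continuous fun x : (Fin K → ℝ) × (Fin K → Fin K → ℝ) => mixture x.1 x.2 := by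
  unfold mixture; fun_prop

lemma sum_mixture {q : Fin K → ℝ} {c : Fin K → Fin K → ℝ} (hq : ∑ i, q i = 1)
    (hc : ∀ i, ∑ l, c i l = 1) : ∑ l, mixture q c l = 1 := by
  simp only [mixture]
  rw [Finset.sum_comm]
  simp [← Finset.sum_mul, hc, hq]

lemma mixture_mem [NeZero K] {q : Fin K → ℝ} {c : Fin K → Fin K → ℝ} (hq : q ∈ openSimplex K)
    (hc : ∀ i, c i ∈ openSimplex K) : mixture q c ∈ openSimplex K :=
  ⟨fun l => Finset.sum_pos (fun i _ => mul_pos ((hc i).1 l) (hq.1 i)) Finset.univ_nonempty,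
    sum_mixture hq.2 fun i => (hc i).2⟩

lemma lintegral_comp_linearMap_add {A : centered K →ₗ[ℝ] centered K} (hA : LinearMap.det A ≠ 0)
    (w : centered K) {F : centered K → ℝ≥0∞} (hF : Measurable F) :
    ∫⁻ h, F (A h + w) = ENNReal.ofReal |(LinearMap.det A)⁻¹| * ∫⁻ h, F h := by
  have hm : Measurable A := A.continuous_of_finiteDimensional.measurable
  have h1 : ∫⁻ h, F (A h + w) = ∫⁻ y, F (y + w) ∂(Measure.map A volume) := by
    rw [lintegral_map (by fun_prop) hm]
  rw [h1, Measure.map_linearMap_addHaar_eq_smul_addHaar _ hA, lintegral_smul_measure,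
    lintegral_add_right_eq_self F w, smul_eq_mul]

/-- With q and the other columns fixed, the mixture is an affine function of column i with linear
part q_i times the identity, and it stays in the simplex. The constant is the inverse Jacobian,
controlled by q_i ≥ η. -/
lemma lintegral_mixture_update_le [NeZero K] {q : Fin K → ℝ} {c : Fin K → Fin K → ℝ}
    (hq : q ∈ openSimplex K) (hc : ∀ i, c i ∈ openSimplex K) {i : Fin K} {η : ℝ} (hη : 0 < η)
    (hqi : η ≤ q i) {T : (Fin K → ℝ) → ℝ≥0∞} (hT : Measurable T) :
    ∫⁻ h in simplexChart K, T (mixture q (Function.update c i (simplexPoint h))) ≤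
      ENNReal.ofReal (η ^ simplexDim K)⁻¹ * ∫⁻ h in simplexChart K, T (simplexPoint h) := by
  have hK : (K : ℝ) ≠ 0 := by exact_mod_cast NeZero.ne K
  have hsum : ∑ l, mixture q (Function.update c i (simplexPoint 0)) l = 1 := by
    refine sum_mixture hq.2 fun j => ?_
    by_cases hj : j = i
    · subst hj; simp [sum_simplexPoint]
    · simp [hj, (hc j).2]
  -- The translation part: the mixture when column i is the barycentre.
  set w := displacement _ hsum
  set A : centered K →ₗ[ℝ] centered K := q i • LinearMap.id
  have hdet : LinearMap.det A = q i ^ simplexDim K := by simp [A]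
  have hmix : ∀ h : centered K,
      mixture q (Function.update c i (simplexPoint h)) = simplexPoint (A h + w) := by
    intro h; ext l
    have h1 : simplexPoint (A h + w) l =
        simplexPoint w l + q i * h.1 l := by
      simp [simplexPoint, A]; ring
    rw [h1, simplexPoint_displacement]
    simp only [mixture]
    rw [← Finset.add_sum_erase _ _ (Finset.mem_univ i),
      ← Finset.add_sum_erase Finset.univ (fun j => Function.update c i (simplexPoint 0) j l * q j)
        (Finset.mem_univ i)]
    have h2 : ∀ x, ∑ j ∈ Finset.univ.erase i, Function.update c i x j l * q j =
        ∑ j ∈ Finset.univ.erase i, c j l * q j := fun x =>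
      Finset.sum_congr rfl fun j hj => by rw [Function.update_of_ne (Finset.ne_of_mem_erase hj)]
    rw [h2, h2]
    simp only [Function.update_self, simplexPoint]
    simp
    ring
  have hqi0 : 0 < q i := hq.1 i
  calc ∫⁻ h in simplexChart K, T (mixture q (Function.update c i (simplexPoint h)))
      ≤ ∫⁻ h, (simplexChart K).indicator (fun h => T (simplexPoint h)) (A h + w) := by
        rw [← lintegral_indicator isOpen_simplexChart.measurableSet]
        refine lintegral_mono fun h => ?_
        by_cases hh : h ∈ simplexChart K
        · have h3 : A h + w ∈ simplexChart K := by
            intro l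
            rw [← hmix h]
            refine (mixture_mem hq fun j => ?_).1 l
            by_cases hj : j = i
            · subst hj; simpa using simplexPoint_mem hh
            · simpa [hj] using hc j
          rw [Set.indicator_of_mem hh, Set.indicator_of_mem h3, hmix]
        · rw [Set.indicator_of_notMem hh]
          exact zero_le
    _ = ENNReal.ofReal |(q i ^ simplexDim K)⁻¹| * ∫⁻ h in simplexChart K, T (simplexPoint h) := by
        rw [lintegral_comp_linearMap_add (by rw [hdet]; positivity) w
          ((by fun_prop : Measurable fun h : centered K => T (simplexPoint h)).indicator
            isOpen_simplexChart.measurableSet), hdet,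
          lintegral_indicator isOpen_simplexChart.measurableSet]
    _ ≤ _ := by
        gcongr
        rw [abs_of_pos (by positivity)]
        gcongr

/-! ### Stability of the inverse problem -/

lemma exists_norm_le_mulVec {C₀ : Matrix (Fin K) (Fin K) ℝ} (hdet : C₀.det ≠ 0) :
    ∃ B > 0, ∀ v : Fin K → ℝ, ‖v‖ ≤ B * ‖C₀ *ᵥ v‖ := by
  set T := (Matrix.toLin' C₀⁻¹).toContinuousLinearMap
  refine ⟨‖T‖ + 1, by positivity, fun v => ?_⟩
  have h1 : T (C₀ *ᵥ v) = v := by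
    simp [T, Matrix.mulVec_mulVec, Matrix.nonsing_inv_mul _ (isUnit_iff_ne_zero.2 hdet)]
  calc ‖v‖ = ‖T (C₀ *ᵥ v)‖ := by rw [h1]
    _ ≤ ‖T‖ * ‖C₀ *ᵥ v‖ := T.le_opNorm _
    _ ≤ _ := by nlinarith [norm_nonneg (C₀ *ᵥ v)]

lemma abs_sub_lt_of_mem_ball {c c₀ : Fin K → ℝ} {r : ℝ} (h : c ∈ Metric.ball c₀ r) (l : Fin K) :
    |c l - c₀ l| < r := by
  rw [← Real.dist_eq]; exact (dist_le_pi_dist c c₀ l).trans_lt h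

lemma norm_mixture_sub_le {C₀ : Matrix (Fin K) (Fin K) ℝ} {c : Fin K → Fin K → ℝ} {r : ℝ}
    (hr : 0 < r) (hc : ∀ i, c i ∈ Metric.ball (columns C₀ i) r) (v : Fin K → ℝ) :
    ‖mixture v c - C₀ *ᵥ v‖ ≤ K * (r * ‖v‖) := by
  refine (pi_norm_le_iff_of_nonneg (by positivity)).2 fun l => ?_
  rw [mulVec_eq_mixture, Pi.sub_apply, mixture, mixture, ← Finset.sum_sub_distrib]
  refine (norm_sum_le _ _).trans ?_
  calc ∑ i, ‖c i l * v i - columns C₀ i l * v i‖ ≤ ∑ _i : Fin K, r * ‖v‖ := by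
        refine Finset.sum_le_sum fun i _ => ?_
        rw [← sub_mul, norm_mul]
        exact mul_le_mul (abs_sub_lt_of_mem_ball (hc i) l).le (norm_le_pi_norm v i) (norm_nonneg _) hr.le
    _ = _ := by simp

/-- The action of a column-stochastic matrix on centered vectors. -/
def mixtureMap (c : Fin K → Fin K → ℝ) (hc : ∀ i, ∑ l, c i l = 1) : centered K →ₗ[ℝ] centered K where
  toFun h := ⟨WithLp.toLp 2 (mixture (fun i => h.1 i) c), by
    simp only [mem_centered, mixture]
    rw [Finset.sum_comm]
    simp [← Finset.sum_mul, hc, sum_centered]⟩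
  map_add' h k := by
    ext l; simp [mixture, mul_add, Finset.sum_add_distrib]
  map_smul' t h := by
    ext l; simp [mixture, Finset.mul_sum]; exact Finset.sum_congr rfl fun i _ => by ring

lemma mixtureMap_apply (c : Fin K → Fin K → ℝ) (hc) (h : centered K) (l : Fin K) :
    (mixtureMap c hc h).1 l = mixture (fun i => h.1 i) c l := rfl

/-- Change of variables q ↦ Cq. For columns near C₀ the map is injective with bounded determinant,
and everything mapped into the ball around C₀q₀ has coordinates bounded below. -/
lemma exists_le_lintegral_mixture [NeZero K] {q₀ : Fin K → ℝ} (hq₀ : q₀ ∈ openSimplex K)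
    {C₀ : Matrix (Fin K) (Fin K) ℝ} (hdet : C₀.det ≠ 0) :
    ∃ r₁ > 0, ∃ β > 0, ∃ κ : ℝ≥0∞, κ ≠ 0 ∧ ∀ r > 0, r ≤ r₁ → ∀ c : Fin K → Fin K → ℝ,
      (∀ i, c i ∈ openSimplex K) → (∀ i, c i ∈ Metric.ball (columns C₀ i) r) →
      ∀ T : (Fin K → ℝ) → ℝ≥0∞, Measurable T →
      κ * ∫⁻ h in chartBall (C₀ *ᵥ q₀) r, T (simplexPoint h) ≤
        ∫⁻ h in chartGe K β, T (mixture (simplexPoint h) c) := by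
  have hK : (1 : ℝ) ≤ K := by exact_mod_cast NeZero.pos K
  obtain ⟨B, hB, hbound⟩ := exists_norm_le_mulVec hdet
  obtain ⟨i₀, hi₀⟩ := Finite.exists_min q₀
  set m := q₀ i₀
  have hm : 0 < m := hq₀.1 i₀
  -- The first bound makes the perturbation of C₀ lose at most a factor 2 in the inverse estimate.
  -- The second keeps preimages within 4BKr ≤ m / 2 of q₀.
  set r₁ := min (1 / (2 * B * K)) (m / (8 * B * K))
  have hr₁ : 0 < r₁ := by positivity
  refine ⟨r₁, hr₁, m / 2, by positivity, ENNReal.ofReal ((K * K) ^ simplexDim K)⁻¹, ?_,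
    fun r hr hrr c hc hcr T hT => ?_⟩
  · simp; positivity
  have hr1 : r * (2 * B * K) ≤ 1 := (le_div_iff₀ (by positivity)).1 (hrr.trans (min_le_left _ _))
  have hr2 : r * (8 * B * K) ≤ m := (le_div_iff₀ (by positivity)).1 (hrr.trans (min_le_right _ _))
  have hc1 : ∀ i, ∑ l, c i l = 1 := fun i => (hc i).2
  have hinv : ∀ v, ‖v‖ ≤ 2 * B * ‖mixture v c‖ := by
    intro v
    have h1 := hbound v
    have h2 := norm_mixture_sub_le hr hcr v
    have h3 : ‖C₀ *ᵥ v‖ ≤ ‖mixture v c‖ + ‖mixture v c - C₀ *ᵥ v‖ := by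
      have := norm_sub_le (mixture v c) (mixture v c - C₀ *ᵥ v)
      rwa [sub_sub_cancel] at this
    have h4 : B * ‖C₀ *ᵥ v‖ ≤ B * (‖mixture v c‖ + K * (r * ‖v‖)) :=
      mul_le_mul_of_nonneg_left (h3.trans (by linarith)) hB.le
    have h5 := mul_le_mul_of_nonneg_right hr1 (norm_nonneg v)
    nlinarith
  set A := mixtureMap c hc1
  have hsum : ∑ l, mixture (simplexPoint 0) c l = 1 := sum_mixture (sum_simplexPoint 0) hc1
  set w := displacement _ hsum
  have hmix : ∀ h : centered K, mixture (simplexPoint h) c = simplexPoint (A h + w) := by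
    intro h; ext l
    have h1 : simplexPoint (A h + w) l = simplexPoint w l + mixture (fun i => h.1 i) c l := by
      rw [← mixtureMap_apply c hc1]
      simp [simplexPoint, A]; ring
    rw [h1, simplexPoint_displacement]
    simp only [mixture, ← Finset.sum_add_distrib, ← mul_add]
    refine Finset.sum_congr rfl fun i _ => ?_
    simp [simplexPoint]
  have hAinj : Function.Injective A := by
    rw [injective_iff_map_eq_zero]
    intro h hh
    have h1 : mixture (fun i => h.1 i) c = 0 := by
      ext l; rw [← mixtureMap_apply c hc1]
      have : (A h).1 l = 0 := by rw [hh]; simp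
      exact this
    have h2 := hinv fun i => h.1 i
    rw [h1, norm_zero, mul_zero, norm_le_zero_iff] at h2
    ext i; exact congrFun h2 i
  have hAdet : LinearMap.det A ≠ 0 :=
    (LinearMap.isUnit_iff_isUnit_det _ |>.1 ((LinearMap.isUnit_iff_ker_eq_bot _).2
      (LinearMap.ker_eq_bot.2 hAinj))).ne_zero
  have hAle : |LinearMap.det A| ≤ (K * K) ^ simplexDim K := by
    refine abs_det_le_of_norm_le A (by positivity) fun h => ?_
    refine (norm_le_of_abs_le _ (R := K * ‖h‖) fun l => ?_).trans_eq (by ring)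
    rw [mixtureMap_apply, mixture]
    refine (Finset.abs_sum_le_sum_abs _ _).trans ?_
    calc ∑ i, |c i l * h.1 i| ≤ ∑ _i : Fin K, ‖h‖ := by
          refine Finset.sum_le_sum fun i _ => ?_
          rw [abs_mul, abs_of_pos ((hc i).1 l)]
          exact (mul_le_of_le_one_left (abs_nonneg _) (le_one_of_mem_openSimplex (hc i) l)).trans
            (abs_apply_le_norm h i)
      _ = K * ‖h‖ := by simp
  have hge : ∀ h : centered K, A h + w ∈ chartBall (C₀ *ᵥ q₀) r → h ∈ chartGe K (m / 2) := by
    intro h hh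
    have h1 : ‖mixture (simplexPoint h) c - C₀ *ᵥ q₀‖ < r := by
      rw [hmix, ← dist_eq_norm]; exact hh
    have h2 := norm_mixture_sub_le hr hcr q₀
    have hq1 : ‖q₀‖ ≤ 1 := (pi_norm_le_iff_of_nonneg zero_le_one).2 fun i => by
      rw [Real.norm_of_nonneg (hq₀.1 i).le]; exact le_one_of_mem_openSimplex hq₀ i
    have h3 : mixture (simplexPoint h - q₀) c =
        (mixture (simplexPoint h) c - C₀ *ᵥ q₀) - (mixture q₀ c - C₀ *ᵥ q₀) := by
      rw [sub_sub_sub_cancel_right]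
      ext l
      simp [mixture, mul_sub, Finset.sum_sub_distrib]
    have h4 : ‖mixture (simplexPoint h - q₀) c‖ ≤ 2 * K * r := by
      rw [h3]
      refine (norm_sub_le _ _).trans ?_
      have h5 : r * ‖q₀‖ ≤ r := mul_le_of_le_one_right hr.le hq1
      nlinarith
    have h6 : ‖simplexPoint h - q₀‖ ≤ m / 2 := by
      refine (hinv _).trans ((mul_le_mul_of_nonneg_left h4 (by positivity)).trans ?_)
      linarith
    intro i
    have h7 := (norm_le_pi_norm (simplexPoint h - q₀) i).trans h6
    rw [Pi.sub_apply, Real.norm_eq_abs, abs_le] at h7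
    linarith [hi₀ i]
  have hball := (isOpen_chartBall (C₀ *ᵥ q₀) r).measurableSet
  calc ENNReal.ofReal ((K * K) ^ simplexDim K)⁻¹ *
        ∫⁻ h in chartBall (C₀ *ᵥ q₀) r, T (simplexPoint h)
      ≤ ENNReal.ofReal |(LinearMap.det A)⁻¹| *
        ∫⁻ h in chartBall (C₀ *ᵥ q₀) r, T (simplexPoint h) := by
        gcongr
        rw [abs_inv]
        exact inv_anti₀ (abs_pos.2 hAdet) hAle
    _ = ∫⁻ h, (chartBall (C₀ *ᵥ q₀) r).indicator (fun h => T (simplexPoint h)) (A h + w) := by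
        rw [lintegral_comp_linearMap_add hAdet w
          ((by fun_prop : Measurable fun h : centered K => T (simplexPoint h)).indicator hball),
          lintegral_indicator hball]
    _ ≤ _ := by
        rw [← lintegral_indicator (measurableSet_chartGe _)]
        refine lintegral_mono fun h => ?_
        by_cases hh : A h + w ∈ chartBall (C₀ *ᵥ q₀) r
        · rw [Set.indicator_of_mem hh, Set.indicator_of_mem (hge h hh), hmix]
        · rw [Set.indicator_of_notMem hh]
          exact zero_le

/-- Each error term (c_i - c₀_i) q_i is at most r in absolute value, by the first factor or by the
second. Hence C₀(q - q₀) is O(r), and so is q - q₀. Then every q_i ≥ r, which excludes the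
small-weight alternative. -/
lemma exists_mem_paramBall [NeZero K] {q₀ : Fin K → ℝ} (hq₀ : q₀ ∈ openSimplex K)
    {C₀ : Matrix (Fin K) (Fin K) ℝ} (hC₀ : ∀ i, columns C₀ i ∈ openSimplex K) (hdet : C₀.det ≠ 0)
    {ε : ℝ} (hε : 0 < ε) :
    ∃ r₁ > 0, ∀ r > 0, r ≤ r₁ → ∀ x : Param K, x.1 ∈ openSimplex K →
      (∀ i, columns x.2 i ∈ openSimplex K) →
      mixture x.1 (columns x.2) ∈ Metric.ball (C₀ *ᵥ q₀) r →
      (∀ i, columns x.2 i ∈ Metric.ball (columns C₀ i) r ∨ x.1 i < r) →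
      x ∈ paramBall q₀ C₀ ε := by
  have hK : (1 : ℝ) ≤ K := by exact_mod_cast NeZero.pos K
  obtain ⟨B, hB, hbound⟩ := exists_norm_le_mulVec hdet
  obtain ⟨i₀, hi₀⟩ := Finite.exists_min q₀
  set m := q₀ i₀
  have hm : 0 < m := hq₀.1 i₀
  set R := B * (K + 1) + 1
  have hR : 0 < R := by positivity
  -- The first bound ensures q_i ≥ m - rR ≥ r; the second turns coordinatewise errors rR into
  -- Euclidean and Frobenius errors below ε.
  refine ⟨min (m / (2 * R)) (ε / (2 * K * R)), by positivity, fun r hr hrr x hq hc hmix hor => ?_⟩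
  have hr1 : r * (2 * R) ≤ m := (le_div_iff₀ (by positivity)).1 (hrr.trans (min_le_left _ _))
  have hr2 : r * (2 * K * R) ≤ ε := (le_div_iff₀ (by positivity)).1 (hrr.trans (min_le_right _ _))
  have h1 : ‖C₀ *ᵥ (x.1 - q₀)‖ ≤ (K + 1) * r := by
    refine (pi_norm_le_iff_of_nonneg (by positivity)).2 fun l => ?_
    have h2 : (C₀ *ᵥ (x.1 - q₀)) l = (mixture x.1 (columns x.2) l - (C₀ *ᵥ q₀) l) -
        ∑ i, (columns x.2 i l - columns C₀ i l) * x.1 i := by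
      simp only [sub_mul, Finset.sum_sub_distrib, Matrix.mulVec_sub, Pi.sub_apply]
      simp only [mulVec_eq_mixture, mixture]
      ring
    have h3 := abs_sub_lt_of_mem_ball hmix l
    have h4 : |∑ i, (columns x.2 i l - columns C₀ i l) * x.1 i| ≤ K * r := by
      refine (Finset.abs_sum_le_sum_abs _ _).trans ?_
      calc ∑ i, |(columns x.2 i l - columns C₀ i l) * x.1 i| ≤ ∑ _i : Fin K, r := by
            refine Finset.sum_le_sum fun i _ => ?_
            rw [abs_mul, abs_of_pos (hq.1 i)]
            rcases hor i with h | h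
            · exact (mul_le_of_le_one_right (abs_nonneg _) (le_one_of_mem_openSimplex hq i)).trans
                (abs_sub_lt_of_mem_ball h l).le
            · refine (mul_le_of_le_one_left (hq.1 i).le ?_).trans h.le
              rw [abs_le]
              have a1 := (hc i).1 l
              have a2 := le_one_of_mem_openSimplex (hc i) l
              have a3 := (hC₀ i).1 l
              have a4 := le_one_of_mem_openSimplex (hC₀ i) l
              constructor <;> linarith
        _ = K * r := by simp
    rw [h2, Real.norm_eq_abs]
    refine (abs_sub _ _).trans ?_
    linarith
  have h2 : ‖x.1 - q₀‖ ≤ r * R := by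
    refine (hbound _).trans ((mul_le_mul_of_nonneg_left h1 hB.le).trans ?_)
    simp only [R]; nlinarith
  have hrR : r ≤ r * R := le_mul_of_one_le_right hr.le (by simp only [R]; nlinarith)
  have h3 : ∀ i, |x.1 i - q₀ i| ≤ r * R := fun i => by
    have := (norm_le_pi_norm (x.1 - q₀) i).trans h2
    rwa [Pi.sub_apply, Real.norm_eq_abs] at this
  have h4 : ∀ i, columns x.2 i ∈ Metric.ball (columns C₀ i) r := fun i => by
    refine (hor i).resolve_right (not_lt.2 ?_)
    have := (abs_le.1 (h3 i)).1
    linarith [hi₀ i]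
  have h5 : ∀ i j, |x.2 j i - C₀ j i| ≤ r * R := fun i j =>
    (abs_sub_lt_of_mem_ball (h4 i) j).le.trans hrR
  have hsq : ∀ {y : ℝ}, |y| ≤ r * R → y ^ 2 ≤ (r * R) ^ 2 := fun h =>
    sq_le_sq' (by linarith [(abs_le.1 h).1]) (abs_le.1 h).2
  have hrR0 : 0 < r * R := by positivity
  constructor
  · refine (Real.sqrt_lt' hε).2 ((Finset.sum_le_sum fun i _ => hsq (h3 i)).trans_lt ?_)
    have h6 : K * (r * R) < ε := by nlinarith
    calc ∑ _i : Fin K, (r * R) ^ 2 = K * (r * R) ^ 2 := by simp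
      _ ≤ (K * (r * R)) ^ 2 := by nlinarith [sq_nonneg (r * R)]
      _ < ε ^ 2 := pow_lt_pow_left₀ h6 (by positivity) two_ne_zero
  · refine (Real.sqrt_lt' hε).2 ((Finset.sum_le_sum fun j _ =>
      Finset.sum_le_sum fun i _ => hsq (h5 i j)).trans_lt ?_)
    have h6 : K * (r * R) < ε := by nlinarith
    calc ∑ _j : Fin K, ∑ _i : Fin K, (r * R) ^ 2 = (K * (r * R)) ^ 2 := by simp; ring
      _ < ε ^ 2 := pow_lt_pow_left₀ h6 (by positivity) two_ne_zero

/-! ### Bounds for the joint prior -/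

/-- The likelihood without its multinomial coefficients. -/
def likelihoodKernel (d : Data K) (q : Fin K → ℝ) (c : Fin K → Fin K → ℝ) : ℝ≥0∞ :=
  (∏ i, monomialWeight (d.1 i) (c i)) * monomialWeight d.2 (mixture q c)

lemma measurableSet_openSimplex : MeasurableSet (openSimplex K) := by
  have : openSimplex K = (⋂ i, {q | 0 < q i}) ∩ {q | ∑ i, q i = 1} := by ext; simp [openSimplex]
  rw [this]
  exact (MeasurableSet.iInter fun i => measurableSet_lt measurable_const (measurable_pi_apply i)).inter
    (measurableSet_eq_fun (by fun_prop) measurable_const)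

lemma measurable_likelihoodKernel (d : Data K) :
    Measurable fun x : (Fin K → ℝ) × (Fin K → Fin K → ℝ) => likelihoodKernel d x.1 x.2 := by
  unfold likelihoodKernel; fun_prop

lemma measurable_comp_columns {F : (Fin K → ℝ) × (Fin K → Fin K → ℝ) → ℝ≥0∞} (hF : Measurable F) :
    Measurable fun x : Param K => F (x.1, columns x.2) :=
  hF.comp (measurable_fst.prodMk (measurable_columns.comp measurable_snd))

lemma lintegral_jointPrior_le [NeZero K] (L : Matrix (Fin K) (Fin K) ℝ) {aq bq aC bC : ℝ}
    (haq : 0 < aq) (hbq : 0 < bq) (haC : 0 < aC) (hbC : 0 < bC)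
    {F : (Fin K → ℝ) × (Fin K → Fin K → ℝ) → ℝ≥0∞} (hF : Measurable F) {D : ℝ≥0∞}
    (hD : ∀ q ∈ openSimplex K, ∫⁻ C, F (q, columns C) ∂priorConfusion L aC bC ≤ D) :
    ∫⁻ x, F (x.1, columns x.2) ∂jointPrior L aq bq aC bC ≤ D := by
  have := isFiniteMeasure_priorTarget L haq hbq
  have := isFiniteMeasure_priorConfusion L haC hbC
  rw [jointPrior, lintegral_prod _ (measurable_comp_columns hF).aemeasurable]
  exact lintegral_priorTarget_le L haq hbq (measurable_comp_columns hF).lintegral_prod_right' hD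

/-- The uniform upper bounds see only open-simplex parameters, so the indicator of the complement
integrates to zero. -/
lemma ae_jointPrior [NeZero K] (L : Matrix (Fin K) (Fin K) ℝ) {aq bq aC bC : ℝ}
    (haq : 0 < aq) (hbq : 0 < bq) (haC : 0 < aC) (hbC : 0 < bC) :
    ∀ᵐ x ∂jointPrior L aq bq aC bC,
      x.1 ∈ openSimplex K ∧ ∀ i, columns x.2 i ∈ openSimplex K := by
  set S : Set ((Fin K → ℝ) × (Fin K → Fin K → ℝ)) :=
    {y | y.1 ∈ openSimplex K ∧ ∀ i, y.2 i ∈ openSimplex K}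
  have hS : MeasurableSet S := by
    have : S = (Prod.fst ⁻¹' openSimplex K) ∩ ⋂ i,
        (fun y : (Fin K → ℝ) × (Fin K → Fin K → ℝ) => y.2 i) ⁻¹' openSimplex K := by
      ext; simp [S]
    rw [this]
    exact (measurable_fst measurableSet_openSimplex).inter (MeasurableSet.iInter fun i =>
      ((measurable_pi_apply i).comp measurable_snd) measurableSet_openSimplex)
  have h1 := lintegral_jointPrior_le L haq hbq haC hbC (F := Sᶜ.indicator 1) (D := 0)
    (measurable_one.indicator hS.compl) fun q hq =>
      lintegral_priorConfusion_le L haC hbC (F := fun c => Sᶜ.indicator 1 (q, c))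
        ((measurable_one.indicator hS.compl).comp measurable_prodMk_left) fun c hc => by
          rw [Set.indicator_of_notMem]
          exact fun h => h ⟨hq, hc⟩
  have h2 := (lintegral_eq_zero_iff
    (measurable_comp_columns (measurable_one.indicator hS.compl))).1 (le_antisymm h1 zero_le)
  filter_upwards [h2] with x hx
  by_contra h
  have : ((x.1, columns x.2) : (Fin K → ℝ) × (Fin K → Fin K → ℝ)) ∈ Sᶜ := h
  rw [Set.indicator_of_mem this] at hx
  exact one_ne_zero hx

lemma exists_le_evidence [NeZero K] {L : Matrix (Fin K) (Fin K) ℝ}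
    (hL : ∀ v : centered K, v ≠ 0 → 0 < centeredForm L v) {aq bq aC bC : ℝ}
    (haq : 0 < aq) (hbq : 0 < bq) (haC : 0 < aC) (hbC : 0 < bC)
    {q₀ : Fin K → ℝ} (hq₀ : q₀ ∈ openSimplex K) {C₀ : Matrix (Fin K) (Fin K) ℝ}
    (hC₀ : ∀ i, columns C₀ i ∈ openSimplex K) (hdet : C₀.det ≠ 0) :
    ∃ r₁ > 0, ∃ κ : ℝ≥0∞, κ ≠ 0 ∧ ∀ r > 0, r ≤ r₁ → ∀ d : Data K,
      κ * (localMass (C₀ *ᵥ q₀) r d.2 * ∏ i, localMass (columns C₀ i) r (d.1 i)) ≤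
        ∫⁻ x, likelihoodKernel d x.1 (columns x.2) ∂jointPrior L aq bq aC bC := by
  have := isFiniteMeasure_priorTarget L haq hbq
  have := isFiniteMeasure_priorConfusion L haC hbC
  obtain ⟨r₂, hr₂, β, hβ, κ₁, hκ₁, hmix⟩ := exists_le_lintegral_mixture hq₀ hdet
  obtain ⟨κ₂, hκ₂, hT⟩ := exists_le_lintegral_priorTarget hL haq hbq hβ
  obtain ⟨⟨i₀, j₀⟩, hmin⟩ := Finite.exists_min fun x : Fin K × Fin K => columns C₀ x.1 x.2
  set m := columns C₀ i₀ j₀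
  have hm : 0 < m := (hC₀ i₀).1 j₀
  have hmin' : ∀ i j, m ≤ columns C₀ i j := fun i j => hmin (i, j)
  obtain ⟨κ₃, hκ₃, hC⟩ := exists_le_lintegral_priorConfusion hL haC hbC (half_pos hm)
  refine ⟨min r₂ (m / 2), by positivity, κ₂ * κ₁ * κ₃, by simp [hκ₁, hκ₂, hκ₃],
    fun r hr hrr d => ?_⟩
  have hrm : ∀ i j, r ≤ columns C₀ i j / 2 := fun i j => by
    have := hrr.trans (min_le_right _ _)
    linarith [hmin' i j]
  -- Truncating each column to its ball lets q be integrated first, at a cost uniform in C, and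
  -- leaves a product over columns.
  set f : Fin K → (Fin K → ℝ) → ℝ≥0∞ := fun i =>
    (openSimplex K ∩ Metric.ball (columns C₀ i) r).indicator (monomialWeight (d.1 i))
  have hfm : ∀ i, Measurable (f i) := fun i =>
    (measurable_monomialWeight _).indicator (measurableSet_openSimplex.inter measurableSet_ball)
  have hloc : ∀ i, localMass (columns C₀ i) r (d.1 i) ≤
      ∫⁻ h in chartGe K (m / 2), f i (simplexPoint h) := by
    intro i
    have hsub : chartBall (columns C₀ i) r ⊆ chartGe K (m / 2) := fun h hh j => by
      have := half_le_of_mem_ball (hrm i) hh j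
      linarith [hmin' i j]
    refine le_trans (le_of_eq ?_) (lintegral_mono_set hsub)
    refine setLIntegral_congr_fun (isOpen_chartBall _ _).measurableSet fun h hh => ?_
    simp only [f]
    have : simplexPoint h ∈ openSimplex K ∩ Metric.ball (columns C₀ i) r :=
      ⟨simplexPoint_mem (chartBall_subset (hC₀ i) (hrm i) hh), hh⟩
    rw [Set.indicator_of_mem this]
  have hG := measurable_comp_columns (measurable_likelihoodKernel d)
  rw [jointPrior, lintegral_prod_symm _ hG.aemeasurable]
  have hinner : ∀ C, (κ₂ * κ₁ * localMass (C₀ *ᵥ q₀) r d.2) * ∏ i, f i (columns C i) ≤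
      ∫⁻ q, likelihoodKernel d q (columns C) ∂priorTarget L aq bq := by
    intro C
    by_cases hCm : ∀ i, columns C i ∈ openSimplex K ∩ Metric.ball (columns C₀ i) r
    · have h1 := (mul_le_mul_right (hmix r hr (hrr.trans (min_le_left _ _)) (columns C)
        (fun i => (hCm i).1) (fun i => (hCm i).2) _ (measurable_monomialWeight d.2)) κ₂).trans
        (hT (fun q => monomialWeight d.2 (mixture q (columns C))) (by fun_prop))
      have h2 : ∏ i, f i (columns C i) = ∏ i, monomialWeight (d.1 i) (columns C i) :=
        Finset.prod_congr rfl fun i _ => Set.indicator_of_mem (hCm i) _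
      simp only [likelihoodKernel]
      rw [lintegral_const_mul _ (by fun_prop), h2, mul_comm, mul_assoc]
      gcongr
      exact h1
    · push Not at hCm
      obtain ⟨i, hi⟩ := hCm
      rw [Finset.prod_eq_zero (Finset.mem_univ i) (Set.indicator_of_notMem hi _), mul_zero]
      exact zero_le
  calc κ₂ * κ₁ * κ₃ * (localMass (C₀ *ᵥ q₀) r d.2 * ∏ i, localMass (columns C₀ i) r (d.1 i))
      = (κ₂ * κ₁ * localMass (C₀ *ᵥ q₀) r d.2) *
          (κ₃ * ∏ i, localMass (columns C₀ i) r (d.1 i)) := by ring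
    _ ≤ (κ₂ * κ₁ * localMass (C₀ *ᵥ q₀) r d.2) *
          (κ₃ * ∏ i, ∫⁻ h in chartGe K (m / 2), f i (simplexPoint h)) := by
        gcongr with i
        exact hloc i
    _ ≤ (κ₂ * κ₁ * localMass (C₀ *ᵥ q₀) r d.2) *
          ∫⁻ C, ∏ i, f i (columns C i) ∂priorConfusion L aC bC :=
        mul_le_mul_right (hC f hfm) _
    _ ≤ ∫⁻ C, (κ₂ * κ₁ * localMass (C₀ *ᵥ q₀) r d.2) * ∏ i, f i (columns C i)
          ∂priorConfusion L aC bC := lintegral_const_mul_le _ _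
    _ ≤ _ := lintegral_mono hinner

/-! ### Upper bounds for the posterior numerator -/

/-- The two concentration bounds for a monomial, relative to a reference mass `I`. -/
structure Concentrates (p : Fin K → ℝ) (r : ℝ) (N γ I : ℝ≥0∞) (k : Fin K → ℕ) : Prop where
  far : ∀ c ∈ openSimplex K, c ∉ Metric.ball p r → jacobianBound c * monomialWeight k c ≤ γ * I
  total : ∫⁻ h in simplexChart K,
    jacobianBound (simplexPoint h) * monomialWeight k (simplexPoint h) ≤ N * I

/-- The target factor is replaced by its supremum over far points; the columns then contribute their
total masses. -/
lemma exists_lintegral_far_target_le [NeZero K] {L : Matrix (Fin K) (Fin K) ℝ}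
    (hL : ∀ v : centered K, 0 ≤ centeredForm L v) {aq bq aC bC : ℝ}
    (haq : 0 < aq) (hbq : 0 < bq) (haC : 0 < aC) (hbC : 0 < bC) :
    ∃ M : ℝ≥0∞, M ≠ ⊤ ∧ ∀ (p : Fin K → ℝ) (r : ℝ) (c₀ : Fin K → Fin K → ℝ) (d : Data K)
      (N J γT : ℝ≥0∞) (I γ : Fin K → ℝ≥0∞), Concentrates p r N γT J d.2 →
      (∀ i, Concentrates (c₀ i) r N (γ i) (I i) (d.1 i)) →
      ∫⁻ x, (∏ i, monomialWeight (d.1 i) (columns x.2 i)) *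
        (Metric.ball p r)ᶜ.indicator (monomialWeight d.2) (mixture x.1 (columns x.2))
        ∂jointPrior L aq bq aC bC ≤ M * N ^ K * γT * (J * ∏ i, I i) := by
  obtain ⟨M, hM, hle⟩ := exists_lintegral_priorConfusion_le hL haC hbC
  refine ⟨M, hM, fun p r c₀ d N J γT I γ hT hC => ?_⟩
  set g := (Metric.ball p r)ᶜ.indicator (monomialWeight d.2)
  have hg : Measurable g := (measurable_monomialWeight _).indicator measurableSet_ball.compl
  have hgle : ∀ c ∈ openSimplex K, g c ≤ γT * J := by
    intro c hc
    by_cases h : c ∈ Metric.ball p r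
    · simp [g, h]
    · simp only [g]
      rw [Set.indicator_of_mem (show c ∈ (Metric.ball p r)ᶜ from h)]
      exact (le_mul_of_one_le_left' (one_le_jacobianBound hc)).trans (hT.far c hc h)
  refine lintegral_jointPrior_le L haq hbq haC hbC
    (F := fun y => (∏ i, monomialWeight (d.1 i) (y.2 i)) * g (mixture y.1 y.2)) (by fun_prop)
    fun q hq => ?_
  -- The coupled column 0 is an arbitrary choice, the bound on g being constant.
  refine (hle (fun i => monomialWeight (d.1 i)) (fun c => g (mixture q c)) (fun i => by fun_prop)
    (by fun_prop) 0 (γT * J) (fun i => N * I i) (fun j _ => (hC j).total) fun c hc => ?_).trans_eq ?_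
  · calc _ ≤ ∫⁻ h in simplexChart K, (γT * J) *
          (jacobianBound (simplexPoint h) * monomialWeight (d.1 0) (simplexPoint h)) := by
          refine setLIntegral_mono' isOpen_simplexChart.measurableSet fun h hh => ?_
          rw [mul_comm (γT * J), mul_assoc (jacobianBound _)]
          gcongr
          refine hgle _ (mixture_mem hq fun j => ?_)
          by_cases hj : j = 0
          · subst hj; simpa using simplexPoint_mem hh
          · simpa [hj] using hc j
      _ = (γT * J) * ∫⁻ h in simplexChart K,
          jacobianBound (simplexPoint h) * monomialWeight (d.1 0) (simplexPoint h) := by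
          refine lintegral_const_mul _ ?_
          unfold jacobianBound; fun_prop
      _ ≤ _ := mul_le_mul_right (hC 0).total _
  · rw [Finset.prod_mul_distrib]; simp; ring

/-- The far column's monomial, Jacobian included, is replaced by its supremum, so its variable
serves to integrate the target monomial. Taking the supremum of the target monomial instead would
lose a factor growing with n', which the decay in the source size need not beat. -/
lemma exists_lintegral_far_column_le [NeZero K] {L : Matrix (Fin K) (Fin K) ℝ}
    (hL : ∀ v : centered K, 0 ≤ centeredForm L v) {aq bq aC bC : ℝ}
    (haq : 0 < aq) (hbq : 0 < bq) (haC : 0 < aC) (hbC : 0 < bC) {r : ℝ} (hr : 0 < r) :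
    ∃ M : ℝ≥0∞, M ≠ ⊤ ∧ ∀ (p : Fin K → ℝ) (c₀ : Fin K → Fin K → ℝ) (d : Data K)
      (N J γT : ℝ≥0∞) (I γ : Fin K → ℝ≥0∞), 1 ≤ N → Concentrates p r N γT J d.2 →
      (∀ i, Concentrates (c₀ i) r N (γ i) (I i) (d.1 i)) → ∀ i,
      ∫⁻ x, {y : (Fin K → ℝ) × (Fin K → Fin K → ℝ) |
          r ≤ y.1 i ∧ y.2 i ∉ Metric.ball (c₀ i) r}.indicator
        (fun y => likelihoodKernel d y.1 y.2) (x.1, columns x.2)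
        ∂jointPrior L aq bq aC bC ≤ M * N ^ (K + 1) * γ i * (J * ∏ i, I i) := by
  obtain ⟨M, hM, hle⟩ := exists_lintegral_priorConfusion_le hL haC hbC
  refine ⟨M * ENNReal.ofReal (r ^ simplexDim K)⁻¹, ENNReal.mul_ne_top hM ENNReal.ofReal_ne_top,
    fun p c₀ d N J γT I γ hN hT hC i => ?_⟩
  set far := {y : (Fin K → ℝ) × (Fin K → Fin K → ℝ) | r ≤ y.1 i ∧ y.2 i ∉ Metric.ball (c₀ i) r}
  have hfar : MeasurableSet far :=
    (measurableSet_le measurable_const ((measurable_pi_apply i).comp measurable_fst)).inter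
      (((measurable_pi_apply i).comp measurable_snd) measurableSet_ball.compl)
  have hker := measurable_likelihoodKernel d
  refine lintegral_jointPrior_le L haq hbq haC hbC (hker.indicator hfar) fun q hq => ?_
  by_cases hqi : r ≤ q i
  swap
  · have : ∀ C : Matrix (Fin K) (Fin K) ℝ, far.indicator
        (fun y => likelihoodKernel d y.1 y.2) (q, columns C) = 0 := fun C =>
      Set.indicator_of_notMem (fun h => hqi h.1) _
    simp [this]
  set f : Fin K → (Fin K → ℝ) → ℝ≥0∞ := Function.update (fun j => monomialWeight (d.1 j)) i
    ((Metric.ball (c₀ i) r)ᶜ.indicator (monomialWeight (d.1 i)))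
  have hfi : f i = (Metric.ball (c₀ i) r)ᶜ.indicator (monomialWeight (d.1 i)) := by simp [f]
  have hfj : ∀ j ≠ i, f j = monomialWeight (d.1 j) := fun j hj => by simp [f, hj]
  have hf : ∀ j, Measurable (f j) := by
    intro j
    by_cases hj : j = i
    · subst hj; rw [hfi]
      exact (measurable_monomialWeight _).indicator measurableSet_ball.compl
    · rw [hfj j hj]; fun_prop
  have heq : ∀ C : Matrix (Fin K) (Fin K) ℝ, far.indicator
      (fun y => likelihoodKernel d y.1 y.2) (q, columns C) ≤
      (∏ j, f j (columns C j)) * monomialWeight d.2 (mixture q (columns C)) := by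
    intro C
    by_cases h : (q, columns C) ∈ far
    · rw [Set.indicator_of_mem h, likelihoodKernel]
      gcongr with j
      by_cases hj : j = i
      · subst hj; rw [hfi, Set.indicator_of_mem h.2]
      · rw [hfj j hj]
    · rw [Set.indicator_of_notMem h]
      exact zero_le
  refine (lintegral_mono heq).trans ?_
  have hTint : ∫⁻ h in simplexChart K, monomialWeight d.2 (simplexPoint h) ≤ N * J :=
    (setLIntegral_mono' isOpen_simplexChart.measurableSet fun h hh =>
      le_mul_of_one_le_left' (one_le_jacobianBound (simplexPoint_mem hh))).trans hT.total
  refine (hle f (fun c => monomialWeight d.2 (mixture q c)) hf (by fun_prop) i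
    (γ i * (ENNReal.ofReal (r ^ simplexDim K)⁻¹ * (N * J))) (fun j => N * I j)
    (fun j hj => ?_) fun c hc => ?_).trans_eq ?_
  · rw [hfj j hj]; exact (hC j).total
  · calc _ ≤ ∫⁻ h in simplexChart K, (γ i * I i) *
          monomialWeight d.2 (mixture q (Function.update c i (simplexPoint h))) := by
          refine setLIntegral_mono' isOpen_simplexChart.measurableSet fun h hh => ?_
          rw [← mul_assoc]
          refine mul_le_mul_left ?_ _
          rw [hfi]
          by_cases hb : simplexPoint h ∈ Metric.ball (c₀ i) r
          · rw [Set.indicator_of_notMem (by simpa using hb), mul_zero]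
            exact zero_le
          · rw [Set.indicator_of_mem hb]
            exact (hC i).far _ (simplexPoint_mem hh) hb
      _ = (γ i * I i) * ∫⁻ h in simplexChart K,
          monomialWeight d.2 (mixture q (Function.update c i (simplexPoint h))) := by
          refine lintegral_const_mul _ ?_
          have hu : Measurable fun h : centered K => Function.update c i (simplexPoint h) :=
            (measurable_update c).comp continuous_simplexPoint.measurable
          fun_prop
      _ ≤ (γ i * I i) * (ENNReal.ofReal (r ^ simplexDim K)⁻¹ * (N * J)) := by
          gcongr
          exact (lintegral_mixture_update_le hq hc hr hqi (measurable_monomialWeight _)).trans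
            (mul_le_mul_right hTint _)
      -- The spare factor N gives column i the same bound N · I i as the other columns.
      _ ≤ γ i * (ENNReal.ofReal (r ^ simplexDim K)⁻¹ * (N * J)) * (N * I i) := by
          rw [mul_right_comm]
          gcongr
          exact le_mul_of_one_le_left' hN
  · rw [Finset.prod_mul_distrib]; simp; ring

/-! ### Chernoff bounds for the multinomial distribution -/

lemma lintegral_multinomialLaw (n : ℕ) (p : Fin K → ℝ) (F : (Fin K → ℕ) → ℝ≥0∞) :
    ∫⁻ k, F k ∂multinomialLaw n p =
      ∑ k ∈ Finset.piAntidiag Finset.univ n, ENNReal.ofReal (multinomialMass n p k) * F k := by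
  simp [multinomialLaw, lintegral_finsetSum_measure, lintegral_smul_measure]

lemma ae_sum_eq_multinomialLaw (n : ℕ) (p : Fin K → ℝ) :
    ∀ᵐ k ∂multinomialLaw n p, ∑ j, k j = n := by
  rw [ae_iff, multinomialLaw]
  simp only [Measure.coe_finsetSum, Finset.sum_apply, Measure.coe_smul, Pi.smul_apply, smul_eq_mul]
  refine Finset.sum_eq_zero fun k hk => ?_
  rw [Measure.dirac_apply' _ (MeasurableSet.of_discrete), Set.indicator_of_notMem, mul_zero]
  simpa using (Finset.mem_piAntidiag.1 hk).1

/-- The multinomial theorem with only the j-th cell probability tilted by exp t. -/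
lemma lintegral_exp_multinomialLaw (n : ℕ) {p : Fin K → ℝ} (hp : p ∈ stdSimplex ℝ (Fin K))
    (j : Fin K) (t : ℝ) :
    ∫⁻ k, ENNReal.ofReal (Real.exp (t * k j)) ∂multinomialLaw n p =
      ENNReal.ofReal ((1 - p j + p j * Real.exp t) ^ n) := by
  have hprod : ∀ k : Fin K → ℕ, ∏ i, (if i = j then Real.exp t else 1) ^ k i = Real.exp (t * k j) := by
    intro k
    rw [Finset.prod_eq_single j (fun i _ hi => by simp [hi]) (by simp), if_pos rfl, mul_comm,
      Real.exp_nat_mul]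
  have hsum : ∑ i, p i * (if i = j then Real.exp t else 1) = 1 - p j + p j * Real.exp t := by
    have h1 : ∀ i, p i * (if i = j then Real.exp t else 1) =
        p i + if i = j then p j * (Real.exp t - 1) else 0 := by
      intro i; split_ifs with h
      · subst h; ring
      · ring
    simp only [h1, Finset.sum_add_distrib, hp.2, Finset.sum_ite_eq', Finset.mem_univ, if_true]
    ring
  have hnn : ∀ k, 0 ≤ multinomialMass n p k := by
    intro k
    unfold multinomialMass
    split_ifs
    · exact mul_nonneg (Nat.cast_nonneg _) (Finset.prod_nonneg fun j _ => pow_nonneg (hp.1 j) _)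
    · exact le_rfl
  rw [lintegral_multinomialLaw, ← hsum, Finset.sum_pow_eq_sum_piAntidiag]
  simp only [← ENNReal.ofReal_mul (hnn _)]
  rw [← ENNReal.ofReal_sum_of_nonneg fun k _ => mul_nonneg (hnn k) (Real.exp_pos _).le]
  congr 1
  refine Finset.sum_congr rfl fun k hk => ?_
  rw [multinomialMass, if_pos (Finset.mem_piAntidiag.1 hk).1, ← hprod, mul_assoc,
    ← Finset.prod_mul_distrib]
  simp only [mul_pow]

/-- Chernoff's method with exp t ≤ 1 + t + t² for |t| ≤ 1. A signed t treats both tails at once. -/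
lemma multinomialLaw_tail_le (n : ℕ) {p : Fin K → ℝ} (hp : p ∈ stdSimplex ℝ (Fin K))
    (j : Fin K) {t : ℝ} (ht : |t| ≤ 1) (s : ℝ) :
    multinomialLaw n p {k | s * n ≤ t * (k j - n * p j)} ≤
      ENNReal.ofReal (Real.exp ((t ^ 2 - s) * n)) := by
  have hp1 : p j ≤ 1 := by
    rw [← hp.2]; exact Finset.single_le_sum (fun i _ => hp.1 i) (Finset.mem_univ j)
  have h1 : (1 - p j + p j * Real.exp t) ^ n ≤ Real.exp ((p j * t + t ^ 2) * n) := by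
    rw [mul_comm _ (n : ℝ), Real.exp_nat_mul]
    refine pow_le_pow_left₀ (by nlinarith [hp.1 j, Real.exp_pos t]) ?_ n
    have h2 := (abs_le.1 (Real.abs_exp_sub_one_sub_id_le ht)).2
    have h3 := Real.add_one_le_exp (p j * t + t ^ 2)
    nlinarith [hp.1 j, sq_nonneg t]
  calc multinomialLaw n p {k | s * n ≤ t * (k j - n * p j)}
      = ∫⁻ k in {k : Fin K → ℕ | s * n ≤ t * (k j - n * p j)}, 1 ∂multinomialLaw n p := by simp
    _ ≤ ∫⁻ k in {k : Fin K → ℕ | s * n ≤ t * (k j - n * p j)},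
          ENNReal.ofReal (Real.exp (-(t * (n * p j)) - s * n)) *
            ENNReal.ofReal (Real.exp (t * k j)) ∂multinomialLaw n p := by
        refine setLIntegral_mono' MeasurableSet.of_discrete fun k hk => ?_
        rw [← ENNReal.ofReal_mul (Real.exp_pos _).le, ← Real.exp_add, ENNReal.one_le_ofReal,
          Real.one_le_exp_iff]
        have : s * n ≤ t * (k j - n * p j) := hk
        linarith
    _ ≤ ∫⁻ k, ENNReal.ofReal (Real.exp (-(t * (n * p j)) - s * n)) *
            ENNReal.ofReal (Real.exp (t * k j)) ∂multinomialLaw n p := setLIntegral_le_lintegral _ _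
    _ = ENNReal.ofReal (Real.exp (-(t * (n * p j)) - s * n)) *
          ENNReal.ofReal ((1 - p j + p j * Real.exp t) ^ n) := by
        rw [lintegral_const_mul' _ _ ENNReal.ofReal_ne_top, lintegral_exp_multinomialLaw n hp]
    _ ≤ ENNReal.ofReal (Real.exp (-(t * (n * p j)) - s * n)) *
          ENNReal.ofReal (Real.exp ((p j * t + t ^ 2) * n)) := by gcongr
    _ = _ := by
        rw [← ENNReal.ofReal_mul (Real.exp_pos _).le, ← Real.exp_add]
        ring_nf

/-- The count vectors with total `n` whose empirical frequencies are within `s` of `p`. -/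
def typicalCounts (n : ℕ) (p : Fin K → ℝ) (s : ℝ) : Set (Fin K → ℕ) :=
  {k | ∑ j, k j = n ∧ ∀ j, |(k j : ℝ) - n * p j| ≤ s * n}

/-- The tail bound at t = ±s/2 with threshold s²/2, over the two tails of each coordinate; s ≤ 2
keeps |t| ≤ 1. -/
lemma multinomialLaw_compl_typicalCounts_le (n : ℕ) {p : Fin K → ℝ}
    (hp : p ∈ stdSimplex ℝ (Fin K)) {s : ℝ} (hs : 0 < s) (hs2 : s ≤ 2) :
    multinomialLaw n p (typicalCounts n p s)ᶜ ≤
      K * (2 * ENNReal.ofReal (Real.exp (-(s ^ 2 / 4) * n))) := by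
  have hsub : (typicalCounts n p s)ᶜ ⊆ {k | ¬ ∑ j, k j = n} ∪ ⋃ j : Fin K,
      ({k | s ^ 2 / 2 * n ≤ s / 2 * (k j - n * p j)} ∪
        {k | s ^ 2 / 2 * n ≤ -(s / 2) * (k j - n * p j)}) := by
    intro k hk
    by_contra h
    simp only [Set.mem_union, Set.mem_iUnion, Set.mem_ofPred_eq, not_or, not_exists, not_le,
      not_not] at h
    refine hk ⟨h.1, fun j => abs_le.2 ?_⟩
    obtain ⟨h1, h2⟩ := h.2 j
    constructor <;> nlinarith
  refine (measure_mono hsub).trans ((measure_union_le _ _).trans ?_)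
  rw [ae_iff.1 (ae_sum_eq_multinomialLaw n p), zero_add]
  refine (measure_iUnion_fintype_le _ _).trans ?_
  calc _ ≤ ∑ _j : Fin K, 2 * ENNReal.ofReal (Real.exp (-(s ^ 2 / 4) * n)) := by
        refine Finset.sum_le_sum fun j _ => (measure_union_le _ _).trans ?_
        rw [two_mul]
        refine add_le_add ?_ ?_
        · refine (multinomialLaw_tail_le n hp j (by rw [abs_of_pos] <;> linarith) _).trans_eq ?_
          ring_nf
        · refine (multinomialLaw_tail_le n hp j
            (by rw [abs_neg, abs_of_pos] <;> linarith) _).trans_eq ?_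
          ring_nf
    _ = _ := by simp

lemma tendsto_multinomialLaw_compl_typicalCounts {p : Fin K → ℝ} (hp : p ∈ stdSimplex ℝ (Fin K))
    {s : ℝ} (hs : 0 < s) :
    Tendsto (fun n => multinomialLaw n p (typicalCounts n p s)ᶜ) atTop (𝓝 0) := by
  set s' := min s 2
  have hs' : 0 < s' := by positivity
  have h1 : Tendsto (fun n : ℕ => ENNReal.ofReal (Real.exp (-(s' ^ 2 / 4) * n))) atTop (𝓝 0) := by
    rw [← ENNReal.ofReal_zero]
    refine ENNReal.tendsto_ofReal (Real.tendsto_exp_atBot.comp ?_)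
    exact tendsto_natCast_atTop_atTop.const_mul_atTop_of_neg (by
      have : 0 < s' ^ 2 / 4 := by positivity
      linarith)
  have h2 : Tendsto (fun n : ℕ => (K : ℝ≥0∞) * (2 * ENNReal.ofReal (Real.exp (-(s' ^ 2 / 4) * n))))
      atTop (𝓝 0) := by
    have := ENNReal.Tendsto.const_mul (a := (K : ℝ≥0∞))
      (ENNReal.Tendsto.const_mul (a := (2 : ℝ≥0∞)) h1 (Or.inr (by simp))) (Or.inr (by simp))
    simpa using this
  refine tendsto_of_tendsto_of_tendsto_of_le_of_le tendsto_const_nhds h2 (fun _ => zero_le)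
    fun n => (measure_mono ?_).trans
      (multinomialLaw_compl_typicalCounts_le n hp hs' (min_le_right _ _))
  refine Set.compl_subset_compl.2 fun k hk => ⟨hk.1, fun j => (hk.2 j).trans ?_⟩
  exact mul_le_mul_of_nonneg_right (min_le_left _ _) (Nat.cast_nonneg n)

lemma dataLaw_compl_le {nS : Fin K → ℕ} {nT : ℕ} {x : Param K}
    (hS : ∀ i, (fun j => x.2 j i) ∈ stdSimplex ℝ (Fin K)) (hT : x.2 *ᵥ x.1 ∈ stdSimplex ℝ (Fin K))
    (A : Fin K → Set (Fin K → ℕ)) (B : Set (Fin K → ℕ)) :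
    dataLaw nS nT x {d | (∀ i, d.1 i ∈ A i) ∧ d.2 ∈ B}ᶜ ≤
      ∑ i, multinomialLaw (nS i) (fun j => x.2 j i) (A i)ᶜ +
        multinomialLaw nT (x.2 *ᵥ x.1) Bᶜ := by
  have := fun i => isProbabilityMeasure_multinomialLaw (nS i) (hS i)
  have := isProbabilityMeasure_multinomialLaw nT hT
  set μ := Measure.pi fun i => multinomialLaw (nS i) (fun j => x.2 j i)
  have hsub : {d : Data K | (∀ i, d.1 i ∈ A i) ∧ d.2 ∈ B}ᶜ ⊆
      (⋃ i, Prod.fst ⁻¹' (Function.eval i ⁻¹' (A i)ᶜ)) ∪ Prod.snd ⁻¹' Bᶜ := by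
    intro d hd
    by_contra h
    simp only [Set.mem_union, Set.mem_iUnion, Set.mem_preimage, Set.mem_compl_iff, not_or,
      not_exists, not_not, Function.eval] at h
    exact hd h
  refine (measure_mono hsub).trans ((measure_union_le _ _).trans (add_le_add ?_ ?_))
  · refine (measure_iUnion_fintype_le _ _).trans (Finset.sum_le_sum fun i _ => ?_)
    rw [dataLaw, (measurePreserving_fst (μ := μ)).measure_preimage
      (MeasurableSet.of_discrete.preimage (measurable_pi_apply i)).nullMeasurableSet,
      (measurePreserving_eval _ i).measure_preimage MeasurableSet.of_discrete.nullMeasurableSet]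
  · rw [dataLaw, (measurePreserving_snd (μ := μ)).measure_preimage
      MeasurableSet.of_discrete.nullMeasurableSet]

/-! ### The posterior -/

lemma measurableSet_paramBall (q₀ : Fin K → ℝ) (C₀ : Matrix (Fin K) (Fin K) ℝ) (ε : ℝ) :
    MeasurableSet (paramBall q₀ C₀ ε) := by
  have h1 : Measurable fun x : Param K => √(∑ i, (x.1 i - q₀ i) ^ 2) := by fun_prop
  have h2 : Measurable fun x : Param K => √(∑ j, ∑ i, (x.2 j i - C₀ j i) ^ 2) :=
    (Finset.measurable_sum _ fun j _ => Finset.measurable_sum _ fun i _ =>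
      ((((measurable_matrix_apply j i).comp measurable_snd).sub_const _).pow_const 2)).sqrt
  exact (measurableSet_lt h1 measurable_const).inter (measurableSet_lt h2 measurable_const)

/-- The product of the multinomial coefficients in the likelihood. -/
def likelihoodConst (d : Data K) : ℝ≥0∞ :=
  ENNReal.ofReal ((∏ i, (Nat.multinomial Finset.univ (d.1 i) : ℝ)) * Nat.multinomial Finset.univ d.2)

lemma likelihoodConst_ne_zero (d : Data K) : likelihoodConst d ≠ 0 := by
  rw [likelihoodConst, Ne, ENNReal.ofReal_eq_zero, not_le]
  have h : ∀ k : Fin K → ℕ, (0 : ℝ) < Nat.multinomial Finset.univ k := fun k => by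
    exact_mod_cast Nat.multinomial_pos _ _
  exact mul_pos (Finset.prod_pos fun i _ => h _) (h _)

lemma ofReal_likelihood [NeZero K] {nS : Fin K → ℕ} {nT : ℕ} {d : Data K}
    (hS : ∀ i, ∑ j, d.1 i j = nS i) (hT : ∑ j, d.2 j = nT) {x : Param K}
    (hc : ∀ i, columns x.2 i ∈ openSimplex K) :
    ENNReal.ofReal (likelihood nS nT d x) =
      likelihoodConst d * likelihoodKernel d x.1 (columns x.2) := by
  have hP : ∀ i, 0 ≤ ∏ j, columns x.2 i j ^ d.1 i j := fun i =>
    Finset.prod_nonneg fun j _ => pow_nonneg ((hc i).1 j).le _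
  simp only [likelihoodConst, likelihoodKernel, monomialWeight]
  rw [← ENNReal.ofReal_prod_of_nonneg fun i _ => hP i,
    ← ENNReal.ofReal_mul (Finset.prod_nonneg fun i _ => hP i), ← ENNReal.ofReal_mul (by positivity)]
  congr 1
  simp only [likelihood, multinomialMass, hS, hT, if_true, Finset.prod_mul_distrib,
    mulVec_eq_mixture]
  simp only [columns]
  ring

section Posterior

variable [NeZero K] (L : Matrix (Fin K) (Fin K) ℝ) {aq bq aC bC : ℝ}

/-- When the counts have the right totals, the multinomial coefficients do not depend on the
parameter and cancel. -/
lemma posterior_apply (haq : 0 < aq) (hbq : 0 < bq) (haC : 0 < aC) (hbC : 0 < bC)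
    {nS : Fin K → ℕ} {nT : ℕ} {d : Data K}
    (hS : ∀ i, ∑ j, d.1 i j = nS i) (hT : ∑ j, d.2 j = nT) {A : Set (Param K)}
    (hA : MeasurableSet A) :
    posterior (jointPrior L aq bq aC bC) nS nT d A =
      (∫⁻ x, likelihoodKernel d x.1 (columns x.2) ∂jointPrior L aq bq aC bC)⁻¹ *
        ∫⁻ x in A, likelihoodKernel d x.1 (columns x.2) ∂jointPrior L aq bq aC bC := by
  have hae : ∀ᵐ x ∂jointPrior L aq bq aC bC, ENNReal.ofReal (likelihood nS nT d x) =
      likelihoodConst d * likelihoodKernel d x.1 (columns x.2) := by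
    filter_upwards [ae_jointPrior L haq hbq haC hbC] with x hx
    exact ofReal_likelihood hS hT hx.2
  have htop : likelihoodConst d ≠ ⊤ := ENNReal.ofReal_ne_top
  have h0 := likelihoodConst_ne_zero d
  rw [posterior, Measure.smul_apply, withDensity_apply _ hA, smul_eq_mul, lintegral_congr_ae hae,
    lintegral_congr_ae (ae_restrict_of_ae hae), lintegral_const_mul' _ _ htop,
    lintegral_const_mul' _ _ htop, ENNReal.mul_inv (Or.inl h0) (Or.inl htop), mul_mul_mul_comm,
    ENNReal.inv_mul_cancel h0 htop, one_mul]

lemma evidence_le_one (haq : 0 < aq) (hbq : 0 < bq) (haC : 0 < aC) (hbC : 0 < bC) (d : Data K) :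
    ∫⁻ x, likelihoodKernel d x.1 (columns x.2) ∂jointPrior L aq bq aC bC ≤ 1 :=
  lintegral_jointPrior_le L haq hbq haC hbC (measurable_likelihoodKernel d) fun _ hq =>
    lintegral_priorConfusion_le L haC hbC
      ((measurable_likelihoodKernel d).comp measurable_prodMk_left) fun _ hc =>
        mul_le_one' (Finset.prod_le_one (fun _ _ => zero_le) fun i _ =>
          monomialWeight_le_one _ (hc i)) (monomialWeight_le_one _ (mixture_mem hq hc))

end Posterior

lemma exists_pos_le_half {ι : Type*} [Finite ι] {p : ι → Fin K → ℝ} (hp : ∀ i j, 0 < p i j) :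
    ∃ r > 0, ∀ i j, r ≤ p i j / 2 := by
  rcases isEmpty_or_nonempty (ι × Fin K) with h | h
  · exact ⟨1, one_pos, fun i j => (h.false (i, j)).elim⟩
  · obtain ⟨⟨i₀, j₀⟩, hmin⟩ := Finite.exists_min fun x : ι × Fin K => p x.1 x.2
    exact ⟨p i₀ j₀ / 2, half_pos (hp i₀ j₀), fun i j => by linarith [hmin (i, j)]⟩

lemma evidence_ne_zero [NeZero K] {L : Matrix (Fin K) (Fin K) ℝ}
    (hL : ∀ v : centered K, v ≠ 0 → 0 < centeredForm L v) {aq bq aC bC : ℝ}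
    (haq : 0 < aq) (hbq : 0 < bq) (haC : 0 < aC) (hbC : 0 < bC)
    {q₀ : Fin K → ℝ} (hq₀ : q₀ ∈ openSimplex K) {C₀ : Matrix (Fin K) (Fin K) ℝ}
    (hC₀ : ∀ i, columns C₀ i ∈ openSimplex K) (hdet : C₀.det ≠ 0) (d : Data K) :
    ∫⁻ x, likelihoodKernel d x.1 (columns x.2) ∂jointPrior L aq bq aC bC ≠ 0 := by
  have hp₀ : C₀ *ᵥ q₀ ∈ openSimplex K := mixture_mem hq₀ hC₀
  obtain ⟨r₁, hr₁, κ, hκ, hle⟩ := exists_le_evidence hL haq hbq haC hbC hq₀ hC₀ hdet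
  obtain ⟨r₂, hr₂, h₂⟩ := exists_pos_le_half fun i => (hC₀ i).1
  obtain ⟨r₃, hr₃, h₃⟩ := exists_pos_le_half fun _ : Unit => hp₀.1
  set r := min r₁ (min r₂ r₃)
  have hr : 0 < r := by positivity
  have h₂' : ∀ i j, r ≤ columns C₀ i j / 2 := fun i j =>
    ((min_le_right _ _).trans (min_le_left _ _)).trans (h₂ i j)
  have h₃' : ∀ j, r ≤ (C₀ *ᵥ q₀) j / 2 := fun j =>
    ((min_le_right _ _).trans (min_le_right _ _)).trans (h₃ () j)
  refine ne_of_gt (lt_of_lt_of_le (pos_iff_ne_zero.2 ?_) (hle r hr (min_le_left _ _) d))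
  exact mul_ne_zero hκ (mul_ne_zero (localMass_ne_zero hp₀ hr h₃' _)
    (Finset.prod_ne_zero_iff.2 fun i _ => localMass_ne_zero (hC₀ i) hr (h₂' i) _))

/-- Numerator and denominator carry the same reference mass E, which cancels and leaves a fixed
constant times the decay rates, each at its own sample size. -/
lemma exists_posterior_compl_le [NeZero K] {L : Matrix (Fin K) (Fin K) ℝ}
    (hL : ∀ v : centered K, v ≠ 0 → 0 < centeredForm L v) {aq bq aC bC : ℝ}
    (haq : 0 < aq) (hbq : 0 < bq) (haC : 0 < aC) (hbC : 0 < bC)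
    {q₀ : Fin K → ℝ} (hq₀ : q₀ ∈ openSimplex K) {C₀ : Matrix (Fin K) (Fin K) ℝ}
    (hC₀ : ∀ i, columns C₀ i ∈ openSimplex K) (hdet : C₀.det ≠ 0) {ε : ℝ} (hε : 0 < ε) :
    ∃ γ : ℕ → ℝ≥0∞, Tendsto γ atTop (𝓝 0) ∧ ∃ s > 0, ∃ n₀ : ℕ,
      ∀ (nS : Fin K → ℕ) (nT : ℕ) (d : Data K), (∀ i, n₀ ≤ nS i) → n₀ ≤ nT →
      (∀ i, d.1 i ∈ typicalCounts (nS i) (columns C₀ i) s) →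
      d.2 ∈ typicalCounts nT (C₀ *ᵥ q₀) s →
      posterior (jointPrior L aq bq aC bC) nS nT d (paramBall q₀ C₀ ε)ᶜ ≤
        γ nT + ∑ i, γ (nS i) := by
  have hL0 : ∀ v : centered K, 0 ≤ centeredForm L v := by
    intro v
    by_cases hv : v = 0
    · have := centeredForm_smul L 0 v
      rw [hv]; simp at this; simp [this]
    · exact (hL v hv).le
  have hp₀ : C₀ *ᵥ q₀ ∈ openSimplex K := mixture_mem hq₀ hC₀
  obtain ⟨r₁, hr₁, κ, hκ, hev⟩ := exists_le_evidence hL haq hbq haC hbC hq₀ hC₀ hdet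
  obtain ⟨r₂, hr₂, h₂⟩ := exists_pos_le_half fun i => (hC₀ i).1
  obtain ⟨r₃, hr₃, h₃⟩ := exists_pos_le_half fun _ : Unit => hp₀.1
  obtain ⟨r₄, hr₄, hgeom⟩ := exists_mem_paramBall hq₀ hC₀ hdet hε
  set r := min (min r₁ r₄) (min r₂ r₃)
  have hr : 0 < r := by positivity
  have hrr₁ : r ≤ r₁ := (min_le_left _ _).trans (min_le_left _ _)
  have hrr₄ : r ≤ r₄ := (min_le_left _ _).trans (min_le_right _ _)
  have h₂' : ∀ i j, r ≤ columns C₀ i j / 2 := fun i j =>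
    ((min_le_right _ _).trans (min_le_left _ _)).trans (h₂ i j)
  have h₃' : ∀ j, r ≤ (C₀ *ᵥ q₀) j / 2 := fun j =>
    ((min_le_right _ _).trans (min_le_right _ _)).trans (h₃ () j)
  obtain ⟨N, hN, γT, hγT, sT, hsT, nT₀, hconcT⟩ := exists_concentration hp₀ hr h₃'
  choose NC hNC γC hγC sC hsC nC₀ hconcC using fun i => exists_concentration (hC₀ i) hr (h₂' i)
  obtain ⟨M₁, hM₁, hnum₁⟩ := exists_lintegral_far_target_le hL0 haq hbq haC hbC
  obtain ⟨M₂, hM₂, hnum₂⟩ := exists_lintegral_far_column_le hL0 haq hbq haC hbC hr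
  set N' := 1 + N + ∑ i, NC i
  have hN'top : N' ≠ ⊤ := ENNReal.add_ne_top.2
    ⟨ENNReal.add_ne_top.2 ⟨ENNReal.one_ne_top, hN⟩, ENNReal.sum_ne_top.2 fun i _ => hNC i⟩
  have hN'one : 1 ≤ N' := le_add_right le_self_add
  have hN'N : N ≤ N' := le_add_right le_add_self
  have hN'C : ∀ i, NC i ≤ N' := fun i =>
    (Finset.single_le_sum (fun _ _ => zero_le) (Finset.mem_univ i)).trans le_add_self
  set D := κ⁻¹ * (M₁ * N' ^ K + M₂ * N' ^ (K + 1))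
  have hD : D ≠ ⊤ := ENNReal.mul_ne_top (ENNReal.inv_ne_top.2 hκ) (ENNReal.add_ne_top.2
    ⟨ENNReal.mul_ne_top hM₁ (ENNReal.pow_ne_top hN'top),
      ENNReal.mul_ne_top hM₂ (ENNReal.pow_ne_top hN'top)⟩)
  obtain ⟨s', hs', hsle⟩ : ∃ s' > 0, ∀ i, s' ≤ sC i := by
    obtain ⟨i₀, hmin⟩ := Finite.exists_min sC
    exact ⟨sC i₀, hsC i₀, hmin⟩
  -- One rate dominating all K + 1 individual ones.
  set γ : ℕ → ℝ≥0∞ := fun n => D * (γT n + ∑ i, γC i n)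
  have hγ : Tendsto γ atTop (𝓝 0) := by
    have h1 : Tendsto (fun n => γT n + ∑ i, γC i n) atTop (𝓝 0) := by
      simpa using hγT.add (tendsto_finsetSum Finset.univ fun i _ => hγC i)
    simpa using ENNReal.Tendsto.const_mul (a := D) h1 (Or.inr hD)
  refine ⟨γ, hγ, min sT s', by positivity, nT₀ + ∑ i, nC₀ i, fun nS nT d hnS hnT hdS hdT => ?_⟩
  have hwid : ∀ {n : ℕ} {x t : ℝ}, |x| ≤ min sT s' * n → min sT s' ≤ t → |x| ≤ t * n :=
    fun h h' => h.trans (mul_le_mul_of_nonneg_right h' (Nat.cast_nonneg _))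
  set J := localMass (C₀ *ᵥ q₀) r d.2
  set I := fun i => localMass (columns C₀ i) r (d.1 i)
  have hcT : Concentrates (C₀ *ᵥ q₀) r N' (γT nT) J d.2 := by
    obtain ⟨h1, h2⟩ := hconcT nT ((Nat.le_add_right _ _).trans hnT) d.2 fun j =>
      hwid (hdT.2 j) (min_le_left _ _)
    exact ⟨h1, h2.trans (mul_le_mul_left hN'N _)⟩
  have hcC : ∀ i, Concentrates (columns C₀ i) r N' (γC i (nS i)) (I i) (d.1 i) := by
    intro i
    have hn : nC₀ i ≤ nS i := (Finset.single_le_sum (fun _ _ => Nat.zero_le _)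
      (Finset.mem_univ i)).trans ((Nat.le_add_left _ _).trans (hnS i))
    obtain ⟨h1, h2⟩ := hconcC i (nS i) hn (d.1 i) fun j =>
      hwid ((hdS i).2 j) ((min_le_right _ _).trans (hsle i))
    exact ⟨h1, h2.trans (mul_le_mul_left (hN'C i) _)⟩
  set E := J * ∏ i, I i
  have hE0 : E ≠ 0 := mul_ne_zero (localMass_ne_zero hp₀ hr h₃' _)
    (Finset.prod_ne_zero_iff.2 fun i _ => localMass_ne_zero (hC₀ i) hr (h₂' i) _)
  have hEtop : E ≠ ⊤ := ENNReal.mul_ne_top (localMass_ne_top hp₀ h₃' _)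
    (ENNReal.prod_ne_top fun i _ => localMass_ne_top (hC₀ i) (h₂' i) _)
  set ρ := jointPrior L aq bq aC bC
  have hden : κ * E ≤ ∫⁻ x, likelihoodKernel d x.1 (columns x.2) ∂ρ := hev r hr hrr₁ d
  set F₁ : Param K → ℝ≥0∞ := fun x => (∏ i, monomialWeight (d.1 i) (columns x.2 i)) *
    (Metric.ball (C₀ *ᵥ q₀) r)ᶜ.indicator (monomialWeight d.2) (mixture x.1 (columns x.2))
  set F₂ : Fin K → Param K → ℝ≥0∞ := fun i x => {y : (Fin K → ℝ) × (Fin K → Fin K → ℝ) |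
    r ≤ y.1 i ∧ y.2 i ∉ Metric.ball (columns C₀ i) r}.indicator
      (fun y => likelihoodKernel d y.1 y.2) (x.1, columns x.2)
  have hF₁ : ∫⁻ x, F₁ x ∂ρ ≤ M₁ * N' ^ K * γT nT * E :=
    hnum₁ _ r (columns C₀) d N' J _ I (fun i => γC i (nS i)) hcT hcC
  have hF₂ : ∀ i, ∫⁻ x, F₂ i x ∂ρ ≤ M₂ * N' ^ (K + 1) * γC i (nS i) * E :=
    hnum₂ _ (columns C₀) d N' J _ I (fun i => γC i (nS i)) hN'one hcT hcC
  have hmF₁ : Measurable F₁ := measurable_comp_columns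
    (F := fun y => (∏ i, monomialWeight (d.1 i) (y.2 i)) *
      (Metric.ball (C₀ *ᵥ q₀) r)ᶜ.indicator (monomialWeight d.2) (mixture y.1 y.2)) (by
    have : Measurable ((Metric.ball (C₀ *ᵥ q₀) r)ᶜ.indicator (monomialWeight d.2)) :=
      (measurable_monomialWeight _).indicator measurableSet_ball.compl
    fun_prop)
  have hmF₂ : ∀ i, Measurable (F₂ i) := fun i =>
    measurable_comp_columns ((measurable_likelihoodKernel d).indicator
      ((measurableSet_le measurable_const ((measurable_pi_apply i).comp measurable_fst)).inter
        (((measurable_pi_apply i).comp measurable_snd) measurableSet_ball.compl)))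
  have hsum : ∫⁻ x in (paramBall q₀ C₀ ε)ᶜ, likelihoodKernel d x.1 (columns x.2) ∂ρ ≤
      ∫⁻ x, (F₁ x + ∑ i, F₂ i x) ∂ρ := by
    rw [← lintegral_indicator (measurableSet_paramBall q₀ C₀ ε).compl]
    refine lintegral_mono_ae ?_
    filter_upwards [ae_jointPrior L haq hbq haC hbC] with x ⟨hq, hc⟩
    by_cases hx : x ∈ (paramBall q₀ C₀ ε)ᶜ
    swap
    · rw [Set.indicator_of_notMem hx]
      exact zero_le
    rw [Set.indicator_of_mem hx]
    -- With the mixture near the truth, `exists_mem_paramBall` provides a far column of weight at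
    -- least r; otherwise the far-target term pays.
    by_cases hm : mixture x.1 (columns x.2) ∈ Metric.ball (C₀ *ᵥ q₀) r
    · have h1 : ¬ ∀ i, columns x.2 i ∈ Metric.ball (columns C₀ i) r ∨ x.1 i < r :=
        fun h => hx (hgeom r hr hrr₄ x hq hc hm h)
      push Not at h1
      obtain ⟨i, hi, hir⟩ := h1
      refine le_trans ?_ le_add_self
      refine le_trans (le_of_eq ?_)
        (Finset.single_le_sum (fun _ _ => zero_le) (Finset.mem_univ i))
      have hmem : ((x.1, columns x.2) : (Fin K → ℝ) × (Fin K → Fin K → ℝ)) ∈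
          {y : (Fin K → ℝ) × (Fin K → Fin K → ℝ) |
            r ≤ y.1 i ∧ y.2 i ∉ Metric.ball (columns C₀ i) r} := ⟨hir, hi⟩
      simp only [F₂]
      rw [Set.indicator_of_mem hmem]
    · refine le_trans (le_of_eq ?_) le_self_add
      simp only [F₁]
      rw [Set.indicator_of_mem (show mixture x.1 (columns x.2) ∈ (Metric.ball (C₀ *ᵥ q₀) r)ᶜ from hm)]
      rfl
  have hnum : ∫⁻ x in (paramBall q₀ C₀ ε)ᶜ, likelihoodKernel d x.1 (columns x.2) ∂ρ ≤
      ((M₁ * N' ^ K + M₂ * N' ^ (K + 1)) * (γT nT + ∑ i, γC i (nS i))) * E := by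
    refine hsum.trans ?_
    rw [lintegral_add_left hmF₁, lintegral_finsetSum _ fun i _ => hmF₂ i]
    refine (add_le_add hF₁ (Finset.sum_le_sum fun i _ => hF₂ i)).trans ?_
    rw [← Finset.sum_mul, ← Finset.mul_sum, ← add_mul, add_mul (M₁ * N' ^ K), mul_add, mul_add]
    refine mul_le_mul_left (add_le_add le_self_add le_add_self) _
  rw [posterior_apply L haq hbq haC hbC (fun i => (hdS i).1) hdT.1
    (measurableSet_paramBall q₀ C₀ ε).compl]
  calc _ ≤ (κ * E)⁻¹ *
        (((M₁ * N' ^ K + M₂ * N' ^ (K + 1)) * (γT nT + ∑ i, γC i (nS i))) * E) :=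
        mul_le_mul' (ENNReal.inv_le_inv.2 hden) hnum
    _ = D * (γT nT + ∑ i, γC i (nS i)) := by
        rw [ENNReal.mul_inv (Or.inr hEtop) (Or.inr hE0)]
        calc _ = κ⁻¹ * (M₁ * N' ^ K + M₂ * N' ^ (K + 1)) * (γT nT + ∑ i, γC i (nS i)) *
              (E⁻¹ * E) := by ring
          _ = _ := by rw [ENNReal.inv_mul_cancel hE0 hEtop, mul_one]
    _ ≤ γ nT + ∑ i, γ (nS i) := by
        simp only [γ]
        rw [← Finset.mul_sum, ← mul_add]
        refine mul_le_mul_right (add_le_add le_self_add (Finset.sum_le_sum fun i _ => ?_)) _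
        exact (Finset.single_le_sum (f := fun j => γC j (nS i)) (fun _ _ => zero_le)
          (Finset.mem_univ i)).trans le_add_self

end LabelShift

end

/-! ### Consistency: passage from typical counts to convergence in probability -/

theorem mainTheorem3 (K : ℕ) (hK : 2 ≤ K)
    (W : Matrix (Fin K) (Fin K) ℝ) (hWsymm : W.IsSymm)
    (hW01 : ∀ i j, W i j ∈ Set.Icc (0 : ℝ) 1)
    (hWconn : (LabelShift.similarityGraph W).Connected)
    (aq bq aC bC : ℝ) (haq : 0 < aq) (hbq : 0 < bq) (haC : 0 < aC) (hbC : 0 < bC)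
    (q₀ : Fin K → ℝ) (hq₀ : q₀ ∈ LabelShift.openSimplex K)
    (C₀ : Matrix (Fin K) (Fin K) ℝ) (hC₀ : ∀ j i, C₀ j i ∈ Set.Ioo (0 : ℝ) 1)
    (hC₀sum : ∀ i, ∑ j, C₀ j i = 1) (hC₀det : C₀.det ≠ 0)
    (nS : ℕ → Fin K → ℕ) (nT : ℕ → ℕ)
    (hnS : ∀ i, Tendsto (fun m => nS m i) atTop atTop) (hnT : Tendsto nT atTop atTop) :
    (∀ m, ∀ᵐ d ∂(LabelShift.dataLaw (nS m) (nT m) (q₀, C₀)),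
      IsProbabilityMeasure
        (LabelShift.posterior (LabelShift.jointPrior (LabelShift.laplacian W) aq bq aC bC)
          (nS m) (nT m) d)) ∧
    ∀ ε : ℝ, 0 < ε → ∀ δ : ℝ≥0∞, 0 < δ →
      Tendsto
        (fun m => LabelShift.dataLaw (nS m) (nT m) (q₀, C₀)
          {d | δ < LabelShift.posterior
            (LabelShift.jointPrior (LabelShift.laplacian W) aq bq aC bC)
            (nS m) (nT m) d (LabelShift.paramBall q₀ C₀ ε)ᶜ})
        atTop (𝓝 0) := by
  have : NeZero K := ⟨by omega⟩
  have hL : ∀ v : LabelShift.centered K, v ≠ 0 →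
      0 < LabelShift.centeredForm (LabelShift.laplacian W) v := fun v hv =>
    LabelShift.centeredForm_laplacian_pos hWsymm (fun i j => (hW01 i j).1) hWconn hv
  have hcol : ∀ i, LabelShift.columns C₀ i ∈ LabelShift.openSimplex K := fun i =>
    ⟨fun j => (hC₀ j i).1, hC₀sum i⟩
  have hsimplex : ∀ {p : Fin K → ℝ}, p ∈ LabelShift.openSimplex K → p ∈ stdSimplex ℝ (Fin K) :=
    fun hp => ⟨fun j => (hp.1 j).le, hp.2⟩
  have hp₀ : C₀ *ᵥ q₀ ∈ LabelShift.openSimplex K := LabelShift.mixture_mem hq₀ hcol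
  have hbad := fun (m : ℕ) (A : Fin K → Set (Fin K → ℕ)) (B : Set (Fin K → ℕ)) =>
    LabelShift.dataLaw_compl_le (nS := nS m) (nT := nT m) (x := (q₀, C₀))
      (fun i => hsimplex (hcol i)) (hsimplex hp₀) A B
  constructor
  · intro m
    -- Almost surely the counts have the prescribed totals; the evidence is then positive and
    -- finite, so normalisation succeeds.
    have h0 := hbad m (fun i => {k | ∑ j, k j = nS m i}) {k | ∑ j, k j = nT m}
    have hz : ∀ (n : ℕ) (p : Fin K → ℝ),
        LabelShift.multinomialLaw n p {k | ∑ j, k j = n}ᶜ = 0 :=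
      fun n p => LabelShift.ae_sum_eq_multinomialLaw n p
    simp only [hz, Finset.sum_const_zero, add_zero, nonpos_iff_eq_zero] at h0
    filter_upwards [mem_ae_iff.2 h0] with d hd
    refine ⟨?_⟩
    rw [LabelShift.posterior_apply _ haq hbq haC hbC hd.1 hd.2 MeasurableSet.univ,
      Measure.restrict_univ]
    exact ENNReal.inv_mul_cancel
      (LabelShift.evidence_ne_zero hL haq hbq haC hbC hq₀ hcol hC₀det d)
      (ne_top_of_le_ne_top ENNReal.one_ne_top
        (LabelShift.evidence_le_one _ haq hbq haC hbC d))
  · intro ε hε δ hδ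
    obtain ⟨γ, hγ, s, hs, n₀, hle⟩ :=
      LabelShift.exists_posterior_compl_le hL haq hbq haC hbC hq₀ hcol hC₀det hε
    have hγsum : Tendsto (fun m => γ (nT m) + ∑ i, γ (nS m i)) atTop (𝓝 0) := by
      simpa using (hγ.comp hnT).add (tendsto_finsetSum Finset.univ fun i _ => hγ.comp (hnS i))
    have htail : Tendsto (fun m =>
        ∑ i, LabelShift.multinomialLaw (nS m i) (LabelShift.columns C₀ i)
          (LabelShift.typicalCounts (nS m i) (LabelShift.columns C₀ i) s)ᶜ +
        LabelShift.multinomialLaw (nT m) (C₀ *ᵥ q₀)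
          (LabelShift.typicalCounts (nT m) (C₀ *ᵥ q₀) s)ᶜ) atTop (𝓝 0) := by
      have h1 := tendsto_finsetSum Finset.univ fun i (_ : i ∈ Finset.univ) =>
        (LabelShift.tendsto_multinomialLaw_compl_typicalCounts (hsimplex (hcol i)) hs).comp (hnS i)
      have h2 := (LabelShift.tendsto_multinomialLaw_compl_typicalCounts (hsimplex hp₀) hs).comp hnT
      simpa using h1.add h2
    refine tendsto_of_tendsto_of_tendsto_of_le_of_le' tendsto_const_nhds htail
      (Eventually.of_forall fun _ => zero_le) ?_
    filter_upwards [hγsum.eventually_lt_const hδ, hnT.eventually_ge_atTop n₀,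
      eventually_all.2 fun i => (hnS i).eventually_ge_atTop n₀] with m hm hmT hmS
    -- Once the deterministic bound is below δ, posterior mass above δ forces atypical counts.
    refine (measure_mono ?_).trans (hbad m
      (fun i => LabelShift.typicalCounts (nS m i) (LabelShift.columns C₀ i) s)
      (LabelShift.typicalCounts (nT m) (C₀ *ᵥ q₀) s))
    intro d hd hgood
    exact absurd ((hle (nS m) (nT m) d hmS hmT hgood.1 hgood.2).trans_lt hm) (not_lt.2 (le_of_lt hd))
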